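/- **Setting.** Let $\mathbb F_q\subseteq\mathbb F_{q^m}\subseteq\mathbb F_{q^{m\eta}}$ be finite fields, let $n,k,r$ be positive integers with $k\le n$, and let $0\le \ell<N$. The public data are a Rank-SD instance $H=(I\,\|\,H')\in\mathbb F_{q^m}^{(n-k)\times n}$, $y\in\mathbb F_{q^m}^{n-k}$; an $(\ell+1,N)$-threshold linear secret sharing scheme over $\mathbb F_q$ (for instance Shamir's), applied coordinatewise to $\mathbb F_q$-vector spaces, together with a public sharing $(u_1,\dots,u_N)\in\mathbb F_q^N$ of the constant $1$ (for Shamir's scheme all $u_i=1$); a commitment function $\mathsf{Com}$; a hash function $\mathsf H_M$ for Merkle trees; and a hash function $\mathsf H$. A *witness* is a vector $x\in\mathbb F_{q^m}^n$ with $Hx=y$ and rank weight $W_R(x)\le r$ over $\mathbb F_q$. **Protocol.** 1. The prover sends $h_0$, meant to be the Merkle root of commitments $\mathsf{Com}(\mathsf{state}_i,\rho_i)$, $1\le i\le N$, where $\mathsf{state}_i=([x_B]_i,[\beta]_i,[a]_i,[c]_i)$ is the share of party $i$ of some $x_B\in\mathbb F_{q^m}^k$, $\beta\in\mathbb F_{q^m}^{r-1}$,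 $a\in\mathbb F_{q^{m\eta}}^{r-1}$, $c\in\mathbb F_{q^{m\eta}}$. 2. The verifier sends uniformly random $\gamma_1,\dots,\gamma_n,e\in\mathbb F_{q^{m\eta}}$. 3. The prover sends a set $S$ of $\ell+1$ parties and a digest $h_1$, meant to be $\mathsf H(([\alpha]_i,[v]_i)_{i\in S})$, where, with $[x]_i=(u_iy-H'[x_B]_i\,\|\,[x_B]_i)$, $$[z]_i=-\sum_j\gamma_j([x_j]_i^{q^r}-[x_j]_i),\quad [\omega_s]_i=\sum_j\gamma_j([x_j]_i^{q^s}-[x_j]_i)\ (1\le s\le r-1),$$ $$[\alpha]_i=e\,[\omega]_i+[a]_i,\qquad [v]_i=e\,[z]_i-\langle\alpha,[\beta]_i\rangle-[c]_i ,$$ and $\alpha$ is the value reconstructed from the shares $[\alpha]_i$. 4. The verifier sends a uniformly random set $I$ of $\ell$ parties. 5. The prover sends $(\mathsf{state}_i,\rho_i)_{i\in I}$ with the Merkle authentication data, a party $i^*\in S\setminus I$ and $[\alpha]_{i^*}$. The verifier rebuilds the Merkle root from the openings; recomputes $[\alpha]_i$ for $i\in I$ and extends these together with $[\alpha]_{i^*}$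 to a full sharing of a value $\alpha$; recomputes $[v]_i$ for $i\in I$ and extends these to the sharing of $v=0$; and accepts iff the root equals $h_0$ and $\mathsf H(([\alpha]_i,[v]_i)_{i\in S})=h_1$. **Theorem.** Let $p=\frac{2}{q^{m\eta}}-\frac1{q^{2m\eta}}$ and $$\epsilon=\frac1{\binom N\ell}+p\cdot\frac{\ell\,(N-\ell)}{\ell+1},$$ and let $\tilde\epsilon>\epsilon$. There is a probabilistic extractor $\mathcal E$ with black-box rewinding access to provers with the following property. (In each call $\mathcal E$ runs the prover, against uniformly random challenges, on a fresh random tape, or rewound to the point just after its first message or just after its second message of an earlier call; $\mathcal E$ sees only the transcripts.) Every output of $\mathcal E$ is read off from accepted transcripts it has seen and is either * a commitment collision: openings $(m,\rho)$, $(m',\rho')$ with $m\ne m'$ and $\mathsf{Com}(m,\rho)=\mathsf{Com}(m',\rho')$, or two distinct inputs, evaluated in the verification of these transcripts, with the same value under $\mathsf H_M$ or under $\mathsf H$; or * a witness $x'=(y-H'x_B\,\|\,x_B)$ of the Rank-SD instance, where $x_B$ is reconstructed from shares that $\ell+1$ parties opened in runs on one and the same tape. For every prover $\tilde{\mathcal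 P}$ that convinces the honest verifier with probability exactly $\tilde\epsilon$, the expected number of calls to $\tilde{\mathcal P}$ that $\mathcal E$ makes until it outputs is at most $$\frac{4}{\tilde\epsilon-\epsilon}\left(1+\frac{8\,(N-\ell)}{\tilde\epsilon-\epsilon}\right)$$ (in particular, $\mathcal E$ produces an output with probability $1$). -/

import Mathlib

open scoped ENNReal

noncomputable section

namespace ThresholdRSD

/-! ### Threshold linear secret sharing -/

/-- A `(t, N)`-threshold linear secret sharing scheme over `F`.  The value of `reconstruct J` is
meaningful only for sets `J` of `t` parties. -/
structure ThresholdLSSS (F : Type*) [Field F] (t N : ℕ) where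
  /-- the randomness space -/
  Rnd : Type
  [rndFintype : Fintype Rnd]
  [rndNonempty : Nonempty Rnd]
  share : F → Rnd → Fin N → F
  reconstruct : (J : Finset (Fin N)) → (J → F) →ₗ[F] F
  correct : ∀ (s : F) (ρ : Rnd) (J : Finset (Fin N)), J.card = t →
    reconstruct J (fun j => share s ρ j) = s
  privacy : ∀ (s₀ s₁ : F) (I : Finset (Fin N)), I.card + 1 = t →
    (PMF.uniformOfFintype Rnd).map (fun ρ => fun i : I => share s₀ ρ i) =
      (PMF.uniformOfFintype Rnd).map (fun ρ => fun i : I => share s₁ ρ i)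

/-- Reconstruction of a secret in an `F`-vector space `V` from the shares of the parties of `J`:
the linear form `reconstruct J` is applied coordinate by coordinate, that is, its coefficients
act on the vectors. -/
def ThresholdLSSS.reconstructVec {F : Type*} [Field F] {t N : ℕ} (σ : ThresholdLSSS F t N)
    {V : Type*} [AddCommGroup V] [Module F V] (J : Finset (Fin N)) (x : Fin N → V) : V :=
  ∑ j : J, σ.reconstruct J (Pi.single j 1) • x j

/-- `x` is a (consistent) sharing of `s`: every set of `t` parties reconstructs `s`. -/
def ThresholdLSSS.IsSharingOf {F : Type*} [Field F] {t N : ℕ} (σ : ThresholdLSSS F t N)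
    {V : Type*} [AddCommGroup V] [Module F V] (x : Fin N → V) (s : V) : Prop :=
  ∀ J : Finset (Fin N), J.card = t → σ.reconstructVec J x = s

/-! ### Parameters, Rank-SD, public data -/

/-- The integer parameters: code length `n`, dimension `k`, rank bound `r`, number of parties `N`,
number `ℓ` of opened parties, length `lam` of the commitment randomness, digest length `d`. -/
structure Params where
  n : ℕ
  k : ℕ
  r : ℕ
  N : ℕ
  ℓ : ℕ
  lam : ℕ
  d : ℕ
  k_pos : 0 < k
  k_le_n : k ≤ n
  r_pos : 0 < r
  ℓ_lt_N : ℓ < N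

/-- Positions of a vector `x = (x_A ‖ x_B)` of length `n = (n - k) + k`. -/
abbrev Pos (P : Params) : Type := Fin (P.n - P.k) ⊕ Fin P.k

/-- Rank weight over `K` of a vector with entries in `L`: the rank of the matrix of its
coordinates in a `K`-basis of `L`. -/
def rankWeight (K : Type*) {L ι : Type*} [Field K] [Field L] [Algebra K L] [Module.Finite K L]
    [Fintype ι] (x : ι → L) : ℕ :=
  (Matrix.of fun i j => (Module.finBasis K L).repr (x i) j).rank

/-- The input share `([x_B], [β], [a], [c])` of one party.  The entry `j` of `β` and `a` has
number `j + 1` in `1, …, r - 1`. -/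
@[ext]
structure State (P : Params) (L M : Type*) where
  xB : Fin P.k → L
  β : Fin (P.r - 1) → L
  a : Fin (P.r - 1) → M
  c : M

/-- Bit strings of length `d`: the digests. -/
abbrev Digest (P : Params) : Type := List.Vector Bool P.d

/-- The random tape of a commitment. -/
abbrev Coins (P : Params) : Type := List.Vector Bool P.lam

/-- The values `([α]_i, [v]_i)` of `ℓ + 1` parties, listed in increasing order of the parties. -/
abbrev Broadcast (P : Params) (M : Type*) : Type _ :=
  Fin (P.ℓ + 1) → (Fin (P.r - 1) → M) × M

/-- Everything public: the instance `(H', y)` with `H = (I ‖ H')`, the secret sharing scheme with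
a public sharing of the constant `1` (all shares equal to `1` for Shamir's scheme), which is what
the parties use to add a public constant to a shared value, and the commitment and hash
functions. -/
structure PublicData (P : Params) (K L M : Type*) [Field K] where
  H' : Matrix (Fin (P.n - P.k)) (Fin P.k) L
  y : Fin (P.n - P.k) → L
  lsss : ThresholdLSSS K (P.ℓ + 1) P.N
  one : Fin P.N → K
  one_isSharing : lsss.IsSharingOf one 1
  /-- the commitment function -/
  com : State P L M → Coins P → List Bool
  /-- the hash function of the Merkle tree -/
  hashM : List Bool → Digest P
  /-- the hash function of the first response -/
  hash : Broadcast P M → Digest P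

section Protocol

variable {P : Params} {K L M : Type*} [Field K] [Field L] [Field M]

/-- `x` solves the Rank-SD instance: `H x = y` and the rank weight of `x` is at most `r`. -/
def IsWitness [Algebra K L] [Module.Finite K L] (D : PublicData P K L M) (x : Pos P → L) : Prop :=
  (Matrix.fromCols 1 D.H').mulVec x = D.y ∧ rankWeight K x ≤ P.r

/-- The vector `(u y - H' x_B ‖ x_B)`; here `u` is the share of the constant `1`. -/
def fullVec [Algebra K L] (D : PublicData P K L M) (u : K) (xB : Fin P.k → L) : Pos P → L :=
  Sum.elim (u • D.y - D.H'.mulVec xB) xB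

/-- The first challenge `((γ_j), ε)`. -/
abbrev Challenge₁ (P : Params) (M : Type*) : Type _ := (Pos P → M) × M

/-- The second challenge: a set of `ℓ` parties. -/
abbrev Challenge₂ (P : Params) : Type := {I : Finset (Fin P.N) // I.card = P.ℓ}

instance (P : Params) : Nonempty (Challenge₂ P) := by
  obtain ⟨s, -, hs⟩ := Finset.exists_subset_card_eq (s := (Finset.univ : Finset (Fin P.N)))
    (n := P.ℓ) (by simpa using P.ℓ_lt_N.le)
  exact ⟨⟨s, hs⟩⟩

/-! ### Local computation of a party -/

section Party

variable [Fintype K] [Algebra K L] [Algebra L M]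

/-- `[z]_i`. -/
def partyZ (D : PublicData P K L M) (ch : Challenge₁ P M) (i : Fin P.N) (st : State P L M) : M :=
  let x : Pos P → L := fullVec D (D.one i) st.xB;
  (-∑ j, ch.1 j * algebraMap L M (x j ^ Fintype.card K ^ P.r - x j))

/-- `[ω]_i`. -/
def partyω (D : PublicData P K L M) (ch : Challenge₁ P M) (i : Fin P.N) (st : State P L M) :
    Fin (P.r - 1) → M := fun e =>
  let x := fullVec D (D.one i) st.xB
  ∑ j, ch.1 j * algebraMap L M (x j ^ Fintype.card K ^ (e.1 + 1) - x j)

/-- `[α]_i`. -/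
def partyα (D : PublicData P K L M) (ch : Challenge₁ P M) (i : Fin P.N) (st : State P L M) :
    Fin (P.r - 1) → M :=
  ch.2 • partyω D ch i st + st.a

/-- `[v]_i`, once the opened value `α` is known. -/
def partyV (D : PublicData P K L M) (ch : Challenge₁ P M) (α : Fin (P.r - 1) → M) (i : Fin P.N)
    (st : State P L M) : M :=
  ch.2 * partyZ D ch i st - ∑ e, α e * algebraMap L M (st.β e) - st.c

end Party

/-! ### Merkle tree -/

open Classical in
/-- The hash at the node whose leaves are `lo, …, lo + len - 1`, rebuilt from the known leaf
values (`leaf i = some v`) and, for every subtree without a known leaf, from the transmitted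
digest `auth lo len`.  If all leaves are known this is the Merkle root of their list. -/
def rebuild {d : ℕ} (hashM : List Bool → List.Vector Bool d) (leaf : ℕ → Option (List Bool))
    (auth : ℕ → ℕ → List.Vector Bool d) (lo len : ℕ) : List.Vector Bool d :=
  if ∀ i, lo ≤ i → i < lo + len → leaf i = none then auth lo len
  else if len ≤ 1 then hashM ((leaf lo).getD [])
  else hashM ((rebuild hashM leaf auth lo (len / 2)).toList ++
    (rebuild hashM leaf auth (lo + len / 2) (len - len / 2)).toList)
termination_by len
decreasing_by all_goals omega

open Classical in
/-- The strings at which `hashM` is evaluated during the computation of `rebuild`. -/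
def rebuildInputs {d : ℕ} (hashM : List Bool → List.Vector Bool d) (leaf : ℕ → Option (List Bool))
    (auth : ℕ → ℕ → List.Vector Bool d) (lo len : ℕ) : Set (List Bool) :=
  if ∀ i, lo ≤ i → i < lo + len → leaf i = none then ∅
  else if len ≤ 1 then {(leaf lo).getD []}
  else {(rebuild hashM leaf auth lo (len / 2)).toList ++
      (rebuild hashM leaf auth (lo + len / 2) (len - len / 2)).toList} ∪
    (rebuildInputs hashM leaf auth lo (len / 2) ∪
      rebuildInputs hashM leaf auth (lo + len / 2) (len - len / 2))
termination_by len
decreasing_by all_goals omega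

/-! ### Messages and verification -/

/-- First response: the public set `S` of `ℓ + 1` parties and the digest `h₁`. -/
structure Response₁ (P : Params) where
  S : {S : Finset (Fin P.N) // S.card = P.ℓ + 1}
  h₁ : Digest P

/-- Second response to the set `I`: the opened states and commitment coins of the parties of `I`,
the authentication data (a digest for each node; only those of the maximal subtrees without a
leaf in `I` are used), the party `i*` and its share of `α`. -/
structure Response₂ (P : Params) (L M : Type*) (I : Challenge₂ P) where
  opening : {i // i ∈ I.1} → State P L M × Coins P
  auth : ℕ → ℕ → Digest P
  iStar : Fin P.N
  αStar : Fin (P.r - 1) → M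

structure Transcript (P : Params) (L M : Type*) where
  h₀ : Digest P
  ch₁ : Challenge₁ P M
  rsp₁ : Response₁ P
  ch₂ : Challenge₂ P
  rsp₂ : Response₂ P L M ch₂

open Classical in
/-- The commitment of party `i`, recomputed from its opening if `i` is an opened party. -/
def Transcript.leaf (D : PublicData P K L M) (T : Transcript P L M) (i : ℕ) :
    Option (List Bool) :=
  if h : ∃ hi : i < P.N, (⟨i, hi⟩ : Fin P.N) ∈ T.ch₂.1 then
    let o := T.rsp₂.opening ⟨⟨i, h.1⟩, h.2⟩
    some (D.com o.1 o.2)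
  else none

/-- `α` (a sharing of `α₀`) and `v` (a sharing of `0`) are the sharings that the verifier recovers
from the transcript: the shares of the opened parties are recomputed from their states, the share
of `α` of `i*` is the transmitted one. -/
def Transcript.Recovers [Fintype K] [Algebra K L] [Algebra L M] [Algebra K M]
    (D : PublicData P K L M) (T : Transcript P L M)
    (α₀ : Fin (P.r - 1) → M) (α : Fin P.N → Fin (P.r - 1) → M) (v : Fin P.N → M) : Prop :=
  D.lsss.IsSharingOf α α₀ ∧ D.lsss.IsSharingOf v 0 ∧
  (∀ i : {i // i ∈ T.ch₂.1}, α i = partyα D T.ch₁ i (T.rsp₂.opening i).1) ∧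
  α T.rsp₂.iStar = T.rsp₂.αStar ∧
  (∀ i : {i // i ∈ T.ch₂.1}, v i = partyV D T.ch₁ α₀ i (T.rsp₂.opening i).1)

/-- `b` is the tuple `([α]_i, [v]_i)_{i ∈ S}` to which the verifier applies `hash`. -/
def Transcript.HashInput [Fintype K] [Algebra K L] [Algebra L M] [Algebra K M]
    (D : PublicData P K L M) (T : Transcript P L M) (b : Broadcast P M) : Prop :=
  ∃ α₀ α v, T.Recovers D α₀ α v ∧
    b = fun j => (α (T.rsp₁.S.1.orderEmbOfFin T.rsp₁.S.2 j),
      v (T.rsp₁.S.1.orderEmbOfFin T.rsp₁.S.2 j))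

/-- The verifier accepts. -/
def Transcript.Accepted [Fintype K] [Algebra K L] [Algebra L M] [Algebra K M]
    (D : PublicData P K L M) (T : Transcript P L M) : Prop :=
  rebuild D.hashM (T.leaf D) T.rsp₂.auth 0 P.N = T.h₀ ∧
  T.rsp₂.iStar ∈ T.rsp₁.S.1 ∧ T.rsp₂.iStar ∉ T.ch₂.1 ∧
  ∃ b, T.HashInput D b ∧ D.hash b = T.rsp₁.h₁

/-! ### Provers -/

/-- An arbitrary (cheating) prover: its messages are functions of its random tape, which is drawn
uniformly, and of the challenges received so far. -/
structure Prover (P : Params) (L M : Type*) where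
  Tape : Type*
  [tapeFintype : Fintype Tape]
  [tapeNonempty : Nonempty Tape]
  commit : Tape → Digest P
  respond₁ : Tape → Challenge₁ P M → Response₁ P
  respond₂ : Tape → Challenge₁ P M → (I : Challenge₂ P) → Response₂ P L M I

attribute [instance] Prover.tapeFintype Prover.tapeNonempty

/-- The transcript of one execution. -/
def Prover.transcript (Q : Prover P L M) (ω : Q.Tape) (c : Challenge₁ P M) (I : Challenge₂ P) :
    Transcript P L M :=
  ⟨Q.commit ω, c, Q.respond₁ ω c, I, Q.respond₂ ω c I⟩

/-- The transcript of an execution with an honest verifier. -/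
def Prover.execution [Fintype M] (Q : Prover P L M) : PMF (Transcript P L M) :=
  (PMF.uniformOfFintype Q.Tape).bind fun ω =>
  (PMF.uniformOfFintype (Challenge₁ P M)).bind fun c =>
  (PMF.uniformOfFintype (Challenge₂ P)).map fun I => Q.transcript ω c I

/-- The probability that the prover convinces the honest verifier. -/
def Prover.acceptProb [Fintype K] [Fintype M] [Algebra K L] [Algebra L M] [Algebra K M]
    (D : PublicData P K L M) (Q : Prover P L M) : ℝ :=
  (Q.execution.toOuterMeasure {T | T.Accepted D}).toReal

/-! ### Extractors -/

/-- What an extractor produces: two openings, two strings for `hashM`, two arguments for `hash`,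
or a vector. -/
inductive Output (P : Params) (L M : Type*) where
  | comCollision (m m' : State P L M) (ρ ρ' : Coins P)
  | merkleCollision (u u' : List Bool)
  | hashCollision (b b' : Broadcast P M)
  | witness (x : Pos P → L)

/-- The output is a genuine collision of one of the commitment functions, or a genuine solution. -/
def Output.Valid [Algebra K L] [Module.Finite K L] (D : PublicData P K L M) :
    Output P L M → Prop
  | .comCollision m m' ρ ρ' => m ≠ m' ∧ D.com m ρ = D.com m' ρ'
  | .merkleCollision u u' => u ≠ u' ∧ D.hashM u = D.hashM u'
  | .hashCollision b b' => b ≠ b' ∧ D.hash b = D.hash b'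
  | .witness x => IsWitness D x

/-- What the extractor sees of one call to the prover: the transcript, the number of the session
(calls with the same random tape of the prover belong to the same session), and the memory `memo`
that the extractor wrote when it decided to make the call. -/
structure Call (P : Params) (L M : Type*) where
  session : ℕ
  memo : ℕ
  T : Transcript P L M

/-- The output is read off from the accepted transcripts among `h`: collisions consist of values
that were opened by the prover or hashed by the verifier, and a vector is
`(y - H' x_B ‖ x_B)` with `x_B` reconstructed from the shares that `ℓ + 1` parties opened in one
session.  (Collisions exist for every compressing function, and a solution may exist without
being known, so this is what makes extraction meaningful.) -/
def Output.ReadOff [Fintype K] [Algebra K L] [Algebra L M] [Algebra K M]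
    (D : PublicData P K L M) (h : List (Call P L M)) : Output P L M → Prop
  | .comCollision m m' ρ ρ' => ∀ o ∈ [(m, ρ), (m', ρ')], ∃ C ∈ h, C.T.Accepted D ∧
      ∃ i, C.T.rsp₂.opening i = o
  | .merkleCollision u u' => ∀ w ∈ [u, u'], ∃ C ∈ h, C.T.Accepted D ∧
      w ∈ rebuildInputs D.hashM (C.T.leaf D) C.T.rsp₂.auth 0 P.N
  | .hashCollision b b' => ∀ w ∈ [b, b'], ∃ C ∈ h, C.T.Accepted D ∧ C.T.HashInput D w
  | .witness x => ∃ (s : ℕ) (J : Finset (Fin P.N)) (st : Fin P.N → State P L M),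
      J.card = P.ℓ + 1 ∧
      (∀ i ∈ J, ∃ C ∈ h, C.session = s ∧ C.T.Accepted D ∧
        ∃ hi : i ∈ C.T.ch₂.1, (C.T.rsp₂.opening ⟨i, hi⟩).1 = st i) ∧
      x = fullVec D 1 (D.lsss.reconstructVec J fun i => (st i).xB)

/-- How the next call to the prover is made: on a fresh tape; on the tape of call number `j`,
rewound to the moment after its commitment (new challenges are drawn); or on the tape of call
number `j`, rewound to the moment after its first response (only a new second challenge is
drawn). -/
inductive Move where
  | fresh
  | rewindCommit (j : ℕ)
  | rewindResponse (j : ℕ)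

/-- An extractor with black-box rewinding access: it sees the calls made so far, decides at random
how to make the next one (and what to remember of this decision), and stops as soon as it has an
output.  It has no other access to the prover. -/
structure Extractor (P : Params) (L M : Type*) where
  next : List (Call P L M) → PMF (ℕ × Move)
  out : List (Call P L M) → Option (Output P L M)

/-- The next call, made on tape `ω` in session `s` with memory `a`; the first challenge is `c?` if it is given, and
uniformly random otherwise; the second challenge is uniformly random. -/
def Prover.call [Fintype M] (Q : Prover P L M) (ω : Q.Tape) (s a : ℕ)
    (c? : Option (Challenge₁ P M)) : PMF (Q.Tape × Call P L M) :=
  (c?.elim (PMF.uniformOfFintype (Challenge₁ P M)) PMF.pure).bind fun c =>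
  (PMF.uniformOfFintype (Challenge₂ P)).map fun I => (ω, ⟨s, a, Q.transcript ω c I⟩)

/-- A call on a fresh uniformly random tape, in the session of number `s`. -/
def Prover.freshCall [Fintype M] (Q : Prover P L M) (s a : ℕ) : PMF (Q.Tape × Call P L M) :=
  (PMF.uniformOfFintype Q.Tape).bind fun ω => Q.call ω s a none

/-- Execution of a move after the calls `h` (kept with their tapes, which the extractor does not
see).  A move that refers to a call that was not made is executed as a fresh call. -/
def Prover.move [Fintype M] (Q : Prover P L M) (h : List (Q.Tape × Call P L M)) (a : ℕ) :
    Move → PMF (Q.Tape × Call P L M)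
  | .fresh => Q.freshCall h.length a
  | .rewindCommit j =>
    match h[j]? with
    | some (ω, C) => Q.call ω C.session a none
    | none => Q.freshCall h.length a
  | .rewindResponse j =>
    match h[j]? with
    | some (ω, C) => Q.call ω C.session a (some C.T.ch₁)
    | none => Q.freshCall h.length a

/-- The distribution of the list of calls after at most `t` calls; nothing is added any more once
the extractor has an output. -/
def Extractor.run [Fintype M] (E : Extractor P L M) (Q : Prover P L M) :
    ℕ → PMF (List (Q.Tape × Call P L M))
  | 0 => PMF.pure []
  | t + 1 => (E.run Q t).bind fun h =>
    match E.out (h.map Prod.snd) with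
    | some _ => PMF.pure h
    | none => (E.next (h.map Prod.snd)).bind fun μ => (Q.move h μ.1 μ.2).map fun C => h ++ [C]

/-- The expected number of calls to the prover: the sum over `t` of the probability that there is
no output after `t` calls, so that call number `t + 1` is made. -/
def Extractor.expectedCalls [Fintype M] (E : Extractor P L M) (Q : Prover P L M) : ℝ≥0∞ :=
  ∑' t, (E.run Q t).toOuterMeasure {h | E.out (h.map Prod.snd) = none}

/-- All outputs of the extractor are correct, and are read off from the transcripts seen. -/
def Extractor.Correct [Fintype K] [Algebra K L] [Module.Finite K L] [Algebra L M] [Algebra K M]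
    (D : PublicData P K L M) (E : Extractor P L M) : Prop :=
  ∀ h o, E.out h = some o → o.Valid D ∧ o.ReadOff D h

end Protocol

/-! ### Constants -/

/-- The false positive rate `2 / q^(mη) - 1 / q^(2mη)` of the multi-party protocol. -/
def falsePositiveRate (K L M : Type*) [Fintype K] [Field K] [Field L] [Field M] [Algebra K L]
    [Algebra L M] : ℝ :=
  2 / (Fintype.card K : ℝ) ^ (Module.finrank K L * Module.finrank L M) -
    1 / (Fintype.card K : ℝ) ^ (2 * (Module.finrank K L * Module.finrank L M))

/-- The soundness error `1 / binom(N, ℓ) + p ℓ (N - ℓ) / (ℓ + 1)`. -/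
def soundnessError (N ℓ : ℕ) (p : ℝ) : ℝ :=
  1 / (N.choose ℓ : ℝ) + p * ((ℓ : ℝ) * ((N : ℝ) - ℓ) / ((ℓ : ℝ) + 1))

end ThresholdRSD

end

/-!
Suppose that no collision occurs.  Then the states opened in one session, that is in runs on one
tape, are bound by the Merkle root, and the broadcast of a repeated first challenge `c` is bound by
`h₁`.  Hence the accepted second challenges that open no new party are contained in the set `G` of
those opened parties that follow the broadcast.  Each set of `ℓ + 1` parties in `G` reconstructs a
state that passes the verification at `c`; as it is not a witness, this happens with probability
at most `p` over `c`.  Since `C(g, ℓ) ≤ 1 + ℓ * C(g, ℓ + 1)`, on average at most `C(N, ℓ) * ε`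
second challenges are accepted without progress: a session on a tape with acceptance probability
`σ` makes progress with probability at least `σ - ε` for each random first challenge.

The extractor collects parties within one session.  Repeating an accepted first challenge until it
is accepted again takes `1 / a` calls, which compensates the probability `a` of getting there.
Sessions on bad tapes must not last, so before each random first challenge the session is given up
with probability `μ / (1 + μ)`, where `μ = δ / (2 * k)`, `δ = ε' - ε` and `k = N - ℓ` bounds the
number of progress steps.  A potential of the history that drops by at least `1` in expectation
with each call then bounds the expected number of calls by its initial value.
-/

open scoped BigOperators

noncomputable section

namespace ThresholdRSD

/-! ### Linear secret sharing -/

namespace ThresholdLSSS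

variable {F : Type*} [Field F] {t N : ℕ} (σ : ThresholdLSSS F t N)

/-- The Lagrange coefficient of party `j` in the reconstruction from the parties of `J`; the value
`0` outside `J` is a convention. -/
def coeff (J : Finset (Fin N)) (j : Fin N) : F :=
  if h : j ∈ J then σ.reconstruct J (Pi.single ⟨j, h⟩ 1) else 0

theorem reconstruct_eq_sum (J : Finset (Fin N)) (x : Fin N → F) :
    σ.reconstruct J (fun j => x j) = ∑ j ∈ J, σ.coeff J j * x j := by
  rw [LinearMap.pi_apply_eq_sum_univ, ← Finset.sum_coe_sort J]
  refine Finset.sum_congr rfl fun j _ => ?_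
  have hj : (fun i : J => if j = i then (1 : F) else 0) = Pi.single j 1 :=
    funext fun i => by simp [Pi.single_apply, eq_comm]
  simp [coeff, hj, mul_comm]

theorem exists_share_eqOn (s₀ s₁ : F) {I : Finset (Fin N)} (hI : I.card + 1 = t) :
    ∃ ρ₀ ρ₁, ∀ i ∈ I, σ.share s₁ ρ₁ i = σ.share s₀ ρ₀ i := by
  let _ := σ.rndFintype
  have _ := σ.rndNonempty
  obtain ⟨ρ₀⟩ := σ.rndNonempty
  have hmem : (fun i : I => σ.share s₀ ρ₀ i) ∈
      ((PMF.uniformOfFintype σ.Rnd).map fun ρ => fun i : I => σ.share s₁ ρ i).support := by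
    rw [← σ.privacy s₀ s₁ I hI, PMF.mem_support_map_iff]
    exact ⟨ρ₀, by simp, rfl⟩
  obtain ⟨ρ₁, -, h⟩ := (PMF.mem_support_map_iff _ _ _).1 hmem
  exact ⟨ρ₀, ρ₁, fun i hi => congrFun h ⟨i, hi⟩⟩

-- If `i` did not contribute, the other parties of `J` alone could tell sharings of `0` and `1`
-- apart.
theorem coeff_ne_zero {J : Finset (Fin N)} (hJ : J.card = t) {i : Fin N} (hi : i ∈ J) :
    σ.coeff J i ≠ 0 := by
  intro h0
  obtain ⟨ρ₀, ρ₁, h⟩ := σ.exists_share_eqOn 0 1 (I := J.erase i)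
    (by rw [Finset.card_erase_add_one hi, hJ])
  refine one_ne_zero (α := F) ?_
  rw [← σ.correct 1 ρ₁ J hJ, ← σ.correct 0 ρ₀ J hJ, reconstruct_eq_sum, reconstruct_eq_sum]
  refine Finset.sum_congr rfl fun j hj => ?_
  obtain rfl | hji := eq_or_ne j i
  · rw [h0, zero_mul, zero_mul]
  · rw [h j (Finset.mem_erase.2 ⟨hji, hj⟩)]

variable {V : Type*} [AddCommGroup V] [Module F V]

theorem reconstructVec_eq_sum (J : Finset (Fin N)) (x : Fin N → V) :
    σ.reconstructVec J x = ∑ j ∈ J, σ.coeff J j • x j := by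
  rw [reconstructVec, ← Finset.sum_coe_sort J]
  exact Finset.sum_congr rfl fun j _ => by simp [coeff]

theorem reconstructVec_congr {J : Finset (Fin N)} {x x' : Fin N → V} (h : ∀ j ∈ J, x j = x' j) :
    σ.reconstructVec J x = σ.reconstructVec J x' := by
  rw [reconstructVec_eq_sum, reconstructVec_eq_sum]
  exact Finset.sum_congr rfl fun j hj => by rw [h j hj]

theorem reconstructVec_apply {ι : Type*} (J : Finset (Fin N)) (x : Fin N → ι → V) (i : ι) :
    σ.reconstructVec J x i = σ.reconstructVec J fun j => x j i := by
  simp [reconstructVec_eq_sum, Finset.sum_apply]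

theorem reconstructVec_map {W : Type*} [AddCommGroup W] [Module F W] (φ : V →ₗ[F] W)
    (J : Finset (Fin N)) (x : Fin N → V) :
    (σ.reconstructVec J fun j => φ (x j)) = φ (σ.reconstructVec J x) := by
  simp [reconstructVec_eq_sum]

theorem reconstructVec_add (J : Finset (Fin N)) (x x' : Fin N → V) :
    (σ.reconstructVec J fun j => x j + x' j) =
      σ.reconstructVec J x + σ.reconstructVec J x' := by
  simp [reconstructVec_eq_sum, Finset.sum_add_distrib]

theorem reconstructVec_sub (J : Finset (Fin N)) (x x' : Fin N → V) :
    (σ.reconstructVec J fun j => x j - x' j) =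
      σ.reconstructVec J x - σ.reconstructVec J x' := by
  simp [reconstructVec_eq_sum, smul_sub]

-- Outside `S`, exchange one party of `S` for the given party: its coefficient is invertible.
theorem IsSharingOf.eq_of_eqOn {σ : ThresholdLSSS F (t + 1) N} {x x' : Fin N → V} {s s' : V}
    (hx : σ.IsSharingOf x s) (hx' : σ.IsSharingOf x' s') {S : Finset (Fin N)}
    (hS : S.card = t + 1) (h : ∀ i ∈ S, x i = x' i) : s = s' ∧ x = x' := by
  have hs : s = s' := by rw [← hx S hS, ← hx' S hS, σ.reconstructVec_congr h]
  refine ⟨hs, funext fun i => ?_⟩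
  by_cases hi : i ∈ S
  · exact h i hi
  obtain ⟨j, hj⟩ : S.Nonempty := Finset.card_pos.1 (by omega)
  have hi' : i ∉ S.erase j := fun h' => hi (Finset.mem_of_mem_erase h')
  have hcard : (insert i (S.erase j)).card = t + 1 := by
    rw [Finset.card_insert_of_notMem hi', Finset.card_erase_add_one hj, hS]
  have e := (hx _ hcard).trans (hs.trans (hx' _ hcard).symm)
  rw [reconstructVec_eq_sum, reconstructVec_eq_sum, Finset.sum_insert hi',
    Finset.sum_insert hi', Finset.sum_congr rfl fun l hl => by
      rw [h l (Finset.mem_of_mem_erase hl)], add_left_inj] at e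
  exact smul_right_injective V (σ.coeff_ne_zero hcard (Finset.mem_insert_self _ _)) e

end ThresholdLSSS

/-! ### Linearized polynomials and rank -/

section Rank

open Polynomial

variable {K L : Type*} [Field K] [Field L] [Algebra K L]

theorem rankWeight_eq_finrank_span [Module.Finite K L] {ι : Type*} [Fintype ι] (x : ι → L) :
    rankWeight K x = Module.finrank K (Submodule.span K (Set.range x)) := by
  let e := (Module.finBasis K L).equivFun
  have h : Submodule.span K (Set.range
      (Matrix.of fun i j => (Module.finBasis K L).repr (x i) j).row) =
      (Submodule.span K (Set.range x)).map (e : L →ₗ[K] _) := by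
    rw [Submodule.map_span, ← Set.range_comp]
    rfl
  rw [rankWeight, Matrix.rank_eq_finrank_span_row, h]
  exact LinearEquiv.finrank_map_eq e _

theorem finrank_le_of_forall_eval_eq_zero [Fintype K] {W : Submodule K L} {f : L[X]} (hf : f ≠ 0)
    {r : ℕ} (hdeg : f.natDegree ≤ Fintype.card K ^ r) (hW : ∀ y ∈ W, f.eval y = 0) :
    Module.finrank K W ≤ r := by
  classical
  have hsub : (W : Set L) ⊆ f.roots.toFinset := fun y hy => by simpa [hf] using hW y hy
  have : Finite W := f.roots.toFinset.finite_toSet.subset hsub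
  refine (Nat.pow_le_pow_iff_right (Fintype.one_lt_card (α := K))).1 ?_
  calc Fintype.card K ^ Module.finrank K W = Nat.card W := by
        rw [Module.natCard_eq_pow_finrank (K := K), Nat.card_eq_fintype_card]
    _ ≤ f.roots.toFinset.card := by
        rw [← Set.ncard_coe_finset]
        exact Set.ncard_le_ncard hsub
    _ ≤ f.natDegree := (Multiset.toFinset_card_le _).trans (card_roots' f)
    _ ≤ Fintype.card K ^ r := hdeg

/-- The polynomial `(X ^ q ^ r - X) + ∑ β_s (X ^ q ^ s - X)`, `1 ≤ s ≤ r - 1`, written with its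
leading term split off. -/
def linearizedPoly (q r : ℕ) (β : Fin (r - 1) → L) : L[X] :=
  X ^ q ^ r + (∑ e : Fin (r - 1), C (β e) * (X ^ q ^ (e.1 + 1) - X) - X)

variable {q r : ℕ}

theorem degree_linearizedPoly_tail_lt (hq : 1 < q) (hr : 0 < r) (β : Fin (r - 1) → L) :
    (∑ e : Fin (r - 1), C (β e) * (X ^ q ^ (e.1 + 1) - X) - X).degree <
      ((q ^ r : ℕ) : WithBot ℕ) := by
  have hX : (X : L[X]).degree < (q ^ r : ℕ) := by
    rw [degree_X]
    exact_mod_cast Nat.one_lt_pow hr.ne' hq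
  refine (degree_sub_le _ _).trans_lt (max_lt ((degree_sum_le _ _).trans_lt ?_) hX)
  rw [Finset.sup_lt_iff (WithBot.bot_lt_coe _)]
  intro e _
  rw [← smul_eq_C_mul]
  refine (degree_smul_le _ _).trans_lt ((degree_sub_le _ _).trans_lt (max_lt ?_ hX))
  rw [degree_X_pow]
  exact_mod_cast Nat.pow_lt_pow_right hq (by omega)

theorem monic_linearizedPoly (hq : 1 < q) (hr : 0 < r) (β : Fin (r - 1) → L) :
    (linearizedPoly q r β).Monic :=
  monic_X_pow_add (degree_linearizedPoly_tail_lt hq hr β)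

theorem natDegree_linearizedPoly (hq : 1 < q) (hr : 0 < r) (β : Fin (r - 1) → L) :
    (linearizedPoly q r β).natDegree = q ^ r := by
  refine natDegree_eq_of_degree_eq_some
    ((degree_add_eq_left_of_degree_lt ?_).trans (degree_X_pow _))
  rw [degree_X_pow]
  exact degree_linearizedPoly_tail_lt hq hr β

variable (K) [Fintype K]

/-- The `K`-linear map `x ↦ x ^ q ^ s - x` of an extension of the finite field `K` with `q`
elements. -/
def frobSub (s : ℕ) : L →ₗ[K] L :=
  ((FiniteField.frobeniusAlgHom K L) ^ s).toLinearMap - LinearMap.id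

theorem frobSub_apply (s : ℕ) (x : L) : frobSub K s x = x ^ Fintype.card K ^ s - x := by
  simp [frobSub, AlgHom.coe_pow, FiniteField.coe_frobeniusAlgHom, pow_iterate]

/-- The `K`-linear map on `L` that the linearized polynomial `linearizedPoly` induces. -/
def linearizedMap (r : ℕ) (β : Fin (r - 1) → L) : L →ₗ[K] L :=
  frobSub K r + ∑ e : Fin (r - 1), (LinearMap.mulLeft K (β e)).comp (frobSub K (e.1 + 1))

theorem linearizedMap_apply (β : Fin (r - 1) → L) (x : L) :
    linearizedMap K r β x = frobSub K r x + ∑ e, β e * frobSub K (e.1 + 1) x := by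
  simp [linearizedMap, LinearMap.sum_apply]

theorem linearizedMap_apply_eq_eval (β : Fin (r - 1) → L) (x : L) :
    linearizedMap K r β x = (linearizedPoly (Fintype.card K) r β).eval x := by
  simp only [linearizedMap_apply, frobSub_apply, linearizedPoly, eval_add, eval_sub, eval_pow,
    eval_X, eval_finsetSum, eval_mul, eval_C]
  ring

theorem rankWeight_le_of_linearizedMap_eq_zero [Module.Finite K L] {ι : Type*} [Fintype ι]
    (hr : 0 < r) (β : Fin (r - 1) → L) {x : ι → L} (h : ∀ j, linearizedMap K r β (x j) = 0) :
    rankWeight K x ≤ r := by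
  have hker : Submodule.span K (Set.range x) ≤ LinearMap.ker (linearizedMap K r β) := by
    refine Submodule.span_le.2 ?_
    rintro _ ⟨j, rfl⟩
    exact h j
  rw [rankWeight_eq_finrank_span]
  exact finrank_le_of_forall_eval_eq_zero (monic_linearizedPoly Fintype.one_lt_card hr β).ne_zero
    (natDegree_linearizedPoly Fintype.one_lt_card hr β).le
    fun y hy => (linearizedMap_apply_eq_eval K β y).symm.trans (hker hy)

end Rank

/-! ### The multi-party computation and its false positives -/

section LinearForm

variable {F V : Type*} [Field F] [AddCommGroup V] [Module F V] [Fintype F] [Fintype V]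
  [DecidableEq F]

theorem card_filter_eq_zero_mul_card {φ : V →ₗ[F] F} (hφ : φ ≠ 0) :
    (Finset.univ.filter fun x => φ x = 0).card * Fintype.card F = Fintype.card V := by
  have hquot : Nat.card (V ⧸ LinearMap.ker φ) = Fintype.card F := by
    rw [← Nat.card_eq_fintype_card]
    exact Nat.card_congr
      (φ.quotKerEquivOfSurjective (LinearMap.surjective hφ)).toEquiv
  have hker : Nat.card (LinearMap.ker φ) = (Finset.univ.filter fun x => φ x = 0).card := by
    rw [← Fintype.card_subtype, ← Nat.card_eq_fintype_card]
    rfl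
  rw [← hquot, ← hker, mul_comm, ← Nat.card_eq_fintype_card,
    Submodule.card_eq_card_quotient_mul_card (LinearMap.ker φ)]
  ring

theorem card_mul_linearForm_eq_le_add (φ : V →ₗ[F] F) (t : F) :
    (Finset.univ.filter fun c : V × F => c.2 * φ c.1 = t).card ≤
      (Finset.univ.filter fun x => φ x = 0).card * Fintype.card F +
        (Finset.univ.filter fun x => φ x ≠ 0).card := by
  have hfib (x : V) : (Finset.univ.filter fun e : F => e * φ x = t).card ≤
      if φ x = 0 then Fintype.card F else 1 := by
    split_ifs with h0
    · exact Finset.card_le_univ _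
    · refine Finset.card_le_one.2 fun a ha b hb => mul_right_cancel₀ h0 ?_
      exact (Finset.mem_filter.1 ha).2.trans (Finset.mem_filter.1 hb).2.symm
  calc (Finset.univ.filter fun c : V × F => c.2 * φ c.1 = t).card
      = ∑ x : V, (Finset.univ.filter fun e : F => e * φ x = t).card := by
        simp_rw [Finset.card_filter]
        exact Fintype.sum_prod_type _
    _ ≤ ∑ x : V, if φ x = 0 then Fintype.card F else 1 := Finset.sum_le_sum fun x _ => hfib x
    _ = _ := by simp [Finset.sum_ite]

theorem card_mul_linearForm_eq_le {φ : V →ₗ[F] F} (hφ : φ ≠ 0) (t : F) :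
    ((Finset.univ.filter fun c : V × F => c.2 * φ c.1 = t).card : ℝ) ≤
      (2 / (Fintype.card F : ℝ) - 1 / (Fintype.card F : ℝ) ^ 2) * Fintype.card (V × F) := by
  set z := (Finset.univ.filter fun x => φ x = 0).card
  have : (0 : ℝ) < Fintype.card F := by exact_mod_cast Fintype.card_pos
  have hV : (z : ℝ) * Fintype.card F = Fintype.card V := by
    exact_mod_cast card_filter_eq_zero_mul_card hφ
  have hnot : (z : ℝ) + (Finset.univ.filter fun x => φ x ≠ 0).card = Fintype.card V := by
    exact_mod_cast Finset.card_filter_add_card_filter_not fun x => φ x = 0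
  calc ((Finset.univ.filter fun c : V × F => c.2 * φ c.1 = t).card : ℝ)
      ≤ z * Fintype.card F + (Finset.univ.filter fun x => φ x ≠ 0).card := by
        exact_mod_cast card_mul_linearForm_eq_le_add φ t
    _ = z * Fintype.card F + (z * Fintype.card F - z) := by linarith
    _ = _ := by
        rw [Fintype.card_prod, Nat.cast_mul, ← hV]
        field_simp
        ring

end LinearForm

theorem falsePositiveRate_nonneg {K L M : Type*} [Fintype K] [Field K] [Field L] [Field M]
    [Algebra K L] [Algebra L M] : 0 ≤ falsePositiveRate K L M := by
  have hQ : (1 : ℝ) ≤ (Fintype.card K : ℝ) ^ (Module.finrank K L * Module.finrank L M) :=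
    one_le_pow₀ (Nat.one_le_cast.2 Fintype.card_pos)
  rw [falsePositiveRate, mul_comm 2 (Module.finrank K L * Module.finrank L M),
    pow_mul _ (Module.finrank K L * Module.finrank L M) 2, sub_nonneg,
    div_le_div_iff₀ (by positivity) (by positivity)]
  nlinarith

section FalsePositiveRate

variable {K L M : Type*} [Field K] [Field L] [Field M] [Fintype K] [Fintype M] [Algebra K L]
  [Algebra L M] [Algebra K M] [IsScalarTower K L M]

theorem falsePositiveRate_eq : falsePositiveRate K L M =
    2 / (Fintype.card M : ℝ) - 1 / (Fintype.card M : ℝ) ^ 2 := by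
  have h : Fintype.card M = Fintype.card K ^ (Module.finrank K L * Module.finrank L M) := by
    rw [Module.finrank_mul_finrank, Module.card_eq_pow_finrank (K := K) (V := M)]
  rw [falsePositiveRate, h]
  push_cast
  rw [← pow_mul, mul_comm 2]

end FalsePositiveRate

section Mpc

variable {P : Params} {K L M : Type*} [Field K] [Field L] [Algebra K L]

theorem reconstructVec_fullVec (D : PublicData P K L M) {J : Finset (Fin P.N)}
    (hJ : J.card = P.ℓ + 1) (xB : Fin P.N → Fin P.k → L) :
    (D.lsss.reconstructVec J fun i => fullVec D (D.one i) (xB i)) =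
      fullVec D (1 : K) (D.lsss.reconstructVec J xB) := by
  ext i
  rw [ThresholdLSSS.reconstructVec_apply]
  cases i with
  | inl i =>
    have hone : (D.lsss.reconstructVec J fun j => D.one j • D.y i) = D.y i := by
      have h := D.lsss.reconstructVec_map (LinearMap.toSpanSingleton K L (D.y i)) J D.one
      simpa [D.one_isSharing J hJ] using h
    have hH' := congrFun
      (D.lsss.reconstructVec_map (D.H'.mulVecLin.restrictScalars K) J xB) i
    rw [ThresholdLSSS.reconstructVec_apply] at hH'
    simp only [fullVec, Sum.elim_inl, Pi.sub_apply, Pi.smul_apply, one_smul]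
    rw [ThresholdLSSS.reconstructVec_sub]
    exact congrArg₂ (· - ·) hone hH'
  | inr i =>
    simp only [fullVec, Sum.elim_inr]
    rw [ThresholdLSSS.reconstructVec_apply]

variable [Field M] [Algebra K M]

/-- The state reconstructed from the shares of the parties of `J`. -/
def reconstructState (D : PublicData P K L M) (J : Finset (Fin P.N))
    (st : Fin P.N → State P L M) : State P L M where
  xB := D.lsss.reconstructVec J fun i => (st i).xB
  β := D.lsss.reconstructVec J fun i => (st i).β
  a := D.lsss.reconstructVec J fun i => (st i).a
  c := D.lsss.reconstructVec J fun i => (st i).c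

theorem reconstructState_congr (D : PublicData P K L M) {J : Finset (Fin P.N)}
    {st st' : Fin P.N → State P L M} (h : ∀ i ∈ J, st i = st' i) :
    reconstructState D J st = reconstructState D J st' := by
  simp only [reconstructState, State.mk.injEq]
  refine ⟨?_, ?_, ?_, ?_⟩ <;>
    exact D.lsss.reconstructVec_congr fun i hi => congrArg _ (h i hi)

variable [Algebra L M] [IsScalarTower K L M]

variable (K) in
/-- The `K`-linear form `b ↦ ⟨γ, b⟩` on the vectors over the subfield `L` of `M`. -/
def pairing {ι : Type*} [Fintype ι] (γ : ι → M) : (ι → L) →ₗ[K] M :=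
  ∑ j, (LinearMap.mulLeft K (γ j)).comp
    ((IsScalarTower.toAlgHom K L M).toLinearMap.comp (LinearMap.proj j))

theorem pairing_apply {ι : Type*} [Fintype ι] (γ : ι → M) (b : ι → L) :
    pairing K γ b = ∑ j, γ j * algebraMap L M (b j) := by
  simp [pairing, LinearMap.sum_apply]

variable [Fintype K]

variable (K) in
/-- The `K`-linear form `x ↦ ∑ γ_j (x_j ^ q ^ s - x_j)`, which computes `-z` for `s = r` and `ω_s`
for `s < r`. -/
def frobComb {ι : Type*} [Fintype ι] (γ : ι → M) (s : ℕ) : (ι → L) →ₗ[K] M :=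
  (pairing K γ).comp ((frobSub K s).compLeft ι)

theorem frobComb_apply {ι : Type*} [Fintype ι] (γ : ι → M) (s : ℕ) (x : ι → L) :
    frobComb K γ s x = ∑ j, γ j * algebraMap L M (x j ^ Fintype.card K ^ s - x j) := by
  simp [frobComb, pairing_apply, frobSub_apply]

/-- The multi-party computation on the secret state `m` outputs `v = 0`. -/
def MpcAccepts (D : PublicData P K L M) (m : State P L M) (ch : Challenge₁ P M) : Prop :=
  let x := fullVec D (1 : K) m.xB
  ch.2 * (-frobComb K ch.1 P.r x) -
    ∑ e, (ch.2 * frobComb K ch.1 (e.1 + 1) x + m.a e) * algebraMap L M (m.β e) - m.c = 0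

theorem reconstructVec_partyα (D : PublicData P K L M) {J : Finset (Fin P.N)}
    (hJ : J.card = P.ℓ + 1) (st : Fin P.N → State P L M) (ch : Challenge₁ P M)
    (e : Fin (P.r - 1)) :
    D.lsss.reconstructVec J (fun i => partyα D ch i (st i)) e =
      ch.2 * frobComb K ch.1 (e.1 + 1) (fullVec D (1 : K) (reconstructState D J st).xB) +
        (reconstructState D J st).a e := by
  simp only [reconstructState]
  rw [← reconstructVec_fullVec D hJ, ← ThresholdLSSS.reconstructVec_map,
    ← LinearMap.mulLeft_apply (R := K), ← ThresholdLSSS.reconstructVec_map,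
    ThresholdLSSS.reconstructVec_apply, ThresholdLSSS.reconstructVec_apply,
    ← ThresholdLSSS.reconstructVec_add]
  simp only [partyα, partyω, Pi.add_apply, Pi.smul_apply, smul_eq_mul, frobComb_apply,
    LinearMap.mulLeft_apply]

theorem reconstructVec_partyV (D : PublicData P K L M) {J : Finset (Fin P.N)}
    (hJ : J.card = P.ℓ + 1) (st : Fin P.N → State P L M) (ch : Challenge₁ P M)
    (α₀ : Fin (P.r - 1) → M) :
    (D.lsss.reconstructVec J fun i => partyV D ch α₀ i (st i)) =
      ch.2 * (-frobComb K ch.1 P.r (fullVec D (1 : K) (reconstructState D J st).xB)) -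
        ∑ e, α₀ e * algebraMap L M ((reconstructState D J st).β e) -
        (reconstructState D J st).c := by
  rw [← pairing_apply (K := K), mul_neg, ← neg_mul]
  simp only [reconstructState]
  rw [← reconstructVec_fullVec D hJ, ← ThresholdLSSS.reconstructVec_map,
    ← LinearMap.mulLeft_apply (R := K), ← ThresholdLSSS.reconstructVec_map,
    ← ThresholdLSSS.reconstructVec_map, ← ThresholdLSSS.reconstructVec_sub,
    ← ThresholdLSSS.reconstructVec_sub]
  simp only [partyV, partyZ, frobComb_apply, pairing_apply, LinearMap.mulLeft_apply, mul_neg,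
    neg_mul]

theorem mpcAccepts_reconstructState (D : PublicData P K L M) {J : Finset (Fin P.N)}
    (hJ : J.card = P.ℓ + 1) (st : Fin P.N → State P L M) (ch : Challenge₁ P M)
    {α₀ : Fin (P.r - 1) → M} {α : Fin P.N → Fin (P.r - 1) → M} {v : Fin P.N → M}
    (hα : D.lsss.IsSharingOf α α₀) (hv : D.lsss.IsSharingOf v 0)
    (hα' : ∀ i ∈ J, α i = partyα D ch i (st i)) (hv' : ∀ i ∈ J, v i = partyV D ch α₀ i (st i)) :
    MpcAccepts D (reconstructState D J st) ch := by
  have hα₀ (e : Fin (P.r - 1)) := reconstructVec_partyα D hJ st ch e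
  simp only [← D.lsss.reconstructVec_congr hα', hα J hJ] at hα₀
  have hv₀ := reconstructVec_partyV D hJ st ch α₀
  rw [← D.lsss.reconstructVec_congr hv', hv J hJ] at hv₀
  simp only [MpcAccepts, ← hα₀, ← hv₀]

-- With `φ(γ) = ∑ γ_j f(x_j)`, `f` the linearized polynomial with coefficients `β`, the output of
-- the computation is `v = -e φ(γ) - ⟨a, β⟩ - c`.
theorem mpcAccepts_iff (D : PublicData P K L M) (m : State P L M) (ch : Challenge₁ P M) :
    MpcAccepts D m ch ↔
      ch.2 * Fintype.linearCombination M
        (fun j => algebraMap L M (linearizedMap K P.r m.β (fullVec D (1 : K) m.xB j))) ch.1 =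
      -(∑ e, m.a e * algebraMap L M (m.β e) + m.c) := by
  set x := fullVec D (1 : K) m.xB with hx
  have hφ : Fintype.linearCombination M
      (fun j => algebraMap L M (linearizedMap K P.r m.β (x j))) ch.1 =
      frobComb K ch.1 P.r x +
        ∑ e, frobComb K ch.1 (e.1 + 1) x * algebraMap L M (m.β e) := by
    simp only [Fintype.linearCombination_apply, smul_eq_mul, linearizedMap_apply, frobComb_apply,
      frobSub_apply, map_add, map_sum, map_mul, mul_add, Finset.sum_add_distrib, Finset.mul_sum,
      Finset.sum_mul]
    rw [Finset.sum_comm]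
    exact congrArg _ (Finset.sum_congr rfl fun e _ => Finset.sum_congr rfl fun j _ => by ring)
  rw [hφ, MpcAccepts, ← hx]
  simp only [add_mul, Finset.sum_add_distrib, mul_add, Finset.mul_sum, mul_assoc]
  constructor <;> intro h <;> linear_combination -h

open Classical in
theorem card_mpcAccepts_le [Fintype M] [Module.Finite K L] (D : PublicData P K L M)
    (m : State P L M) (hm : ¬ rankWeight K (fullVec D (1 : K) m.xB) ≤ P.r) :
    ((Finset.univ.filter fun ch : Challenge₁ P M => MpcAccepts D m ch).card : ℝ) ≤
      falsePositiveRate K L M * Fintype.card (Challenge₁ P M) := by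
  set φ : (Pos P → M) →ₗ[M] M := Fintype.linearCombination M
    (fun j => algebraMap L M (linearizedMap K P.r m.β (fullVec D (1 : K) m.xB j))) with hφ
  have hφ0 : φ ≠ 0 := by
    refine fun h0 => hm (rankWeight_le_of_linearizedMap_eq_zero K P.r_pos m.β fun j => ?_)
    have hj := LinearMap.congr_fun h0 (Pi.single j 1)
    rw [hφ, Fintype.linearCombination_apply_single, one_smul, LinearMap.zero_apply] at hj
    exact (map_eq_zero _).1 hj
  rw [falsePositiveRate_eq, Finset.filter_congr fun ch _ => mpcAccepts_iff D m ch]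
  convert card_mul_linearForm_eq_le hφ0 _

end Mpc

/-! ### Merkle trees -/

theorem exists_collision_of_rebuild_eq {d : ℕ} (hashM : List Bool → List.Vector Bool d)
    (leaf leaf' : ℕ → Option (List Bool)) (auth auth' : ℕ → ℕ → List.Vector Bool d)
    {i : ℕ} {v v' : List Bool} (hv : leaf i = some v) (hv' : leaf' i = some v') (hne : v ≠ v')
    (len : ℕ) : ∀ lo, lo ≤ i → i < lo + len →
      rebuild hashM leaf auth lo len = rebuild hashM leaf' auth' lo len →
      ∃ u ∈ rebuildInputs hashM leaf auth lo len, ∃ u' ∈ rebuildInputs hashM leaf' auth' lo len,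
        u ≠ u' ∧ hashM u = hashM u' := by
  induction len using Nat.strong_induction_on with
  | _ len ih =>
    intro lo hlo hhi heq
    have hk : ¬ ∀ j, lo ≤ j → j < lo + len → leaf j = none := fun h => by
      simpa [hv] using h i hlo hhi
    have hk' : ¬ ∀ j, lo ≤ j → j < lo + len → leaf' j = none := fun h => by
      simpa [hv'] using h i hlo hhi
    rw [rebuild.eq_def _ leaf _ lo len, rebuild.eq_def _ leaf' _ lo len, if_neg hk,
      if_neg hk'] at heq
    rw [rebuildInputs.eq_def _ leaf _ lo len, rebuildInputs.eq_def _ leaf' _ lo len, if_neg hk,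
      if_neg hk']
    by_cases hlen : len ≤ 1
    · obtain rfl : i = lo := by omega
      rw [if_pos hlen, if_pos hlen, hv, hv'] at heq
      rw [if_pos hlen, if_pos hlen, hv, hv']
      exact ⟨v, rfl, v', rfl, hne, heq⟩
    · rw [if_neg hlen, if_neg hlen] at heq
      rw [if_neg hlen, if_neg hlen]
      by_cases hcat : (rebuild hashM leaf auth lo (len / 2)).toList ++
          (rebuild hashM leaf auth (lo + len / 2) (len - len / 2)).toList =
          (rebuild hashM leaf' auth' lo (len / 2)).toList ++
          (rebuild hashM leaf' auth' (lo + len / 2) (len - len / 2)).toList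
      · obtain ⟨h₁, h₂⟩ := List.append_inj hcat (by simp)
        by_cases hi : i < lo + len / 2
        · obtain ⟨u, hu, u', hu', h⟩ := ih (len / 2) (by omega) lo hlo hi (List.Vector.eq _ _ h₁)
          exact ⟨u, Or.inr (Or.inl hu), u', Or.inr (Or.inl hu'), h⟩
        · obtain ⟨u, hu, u', hu', h⟩ := ih (len - len / 2) (by omega) (lo + len / 2) (by omega)
            (by omega) (List.Vector.eq _ _ h₂)
          exact ⟨u, Or.inr (Or.inr hu), u', Or.inr (Or.inr hu'), h⟩
      · exact ⟨_, Or.inl rfl, _, Or.inl rfl, hcat, heq⟩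

theorem choose_le_one_add_mul_choose_succ (g ℓ : ℕ) :
    g.choose ℓ ≤ 1 + ℓ * g.choose (ℓ + 1) := by
  obtain h | rfl | h : g ≤ ℓ ∨ g = ℓ + 1 ∨ ℓ + 2 ≤ g := by omega
  · have h1 : g.choose ℓ ≤ 1 := (Nat.choose_le_choose ℓ h).trans (Nat.choose_self ℓ).le
    omega
  · simp [Nat.choose_succ_self_right, add_comm]
  · have h1 := Nat.choose_succ_right_eq g ℓ
    have h2 : g.choose ℓ * 2 ≤ g.choose ℓ * (g - ℓ) := Nat.mul_le_mul_left _ (by omega)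
    cases ℓ with
    | zero => simp
    | succ ℓ => nlinarith

/-! ### What a list of calls reveals -/

section Opened

variable {P : Params} {K L M : Type*}

/-- The state `m` of party `i` was opened in session `s` of the numbered transcripts `κ`. -/
def Opened (κ : Set (ℕ × Transcript P L M)) (s : ℕ) (i : Fin P.N) (m : State P L M) : Prop :=
  ∃ T, (s, T) ∈ κ ∧ ∃ hi : i ∈ T.ch₂.1, (T.rsp₂.opening ⟨i, hi⟩).1 = m

variable {κ κ' : Set (ℕ × Transcript P L M)} {s : ℕ} {i : Fin P.N}

theorem Opened.mono (hκ : κ ⊆ κ') {m : State P L M} (h : Opened κ s i m) : Opened κ' s i m := by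
  obtain ⟨T, hT, h⟩ := h
  exact ⟨T, hκ hT, h⟩

open Classical in
/-- The parties that were opened in session `s`. -/
def openedParties (κ : Set (ℕ × Transcript P L M)) (s : ℕ) : Finset (Fin P.N) :=
  Finset.univ.filter fun i => ∃ m, Opened κ s i m

theorem mem_openedParties : i ∈ openedParties κ s ↔ ∃ m, Opened κ s i m := by
  simp [openedParties]

theorem openedParties_mono (hκ : κ ⊆ κ') (s : ℕ) : openedParties κ s ⊆ openedParties κ' s :=
  fun _ hi => mem_openedParties.2 ((mem_openedParties.1 hi).imp fun _ hm => hm.mono hκ)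

variable [Field L] [Field M]

instance : Nonempty (State P L M) := ⟨⟨0, 0, 0, 0⟩⟩

/-- A state that party `i` opened in session `s`; arbitrary if there is none. -/
def openedState (κ : Set (ℕ × Transcript P L M)) (s : ℕ) (i : Fin P.N) : State P L M :=
  Classical.epsilon (Opened κ s i)

theorem opened_openedState (hi : i ∈ openedParties κ s) : Opened κ s i (openedState κ s i) :=
  Classical.epsilon_spec (mem_openedParties.1 hi)

end Opened

section Knowledge

variable {P : Params} {K L M : Type*}

theorem Transcript.leaf_eq [Field K] (D : PublicData P K L M) (T : Transcript P L M) {i : Fin P.N}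
    (hi : i ∈ T.ch₂.1) : T.leaf D i.1 =
      some (D.com (T.rsp₂.opening ⟨i, hi⟩).1 (T.rsp₂.opening ⟨i, hi⟩).2) := by
  rw [Transcript.leaf, dif_pos ⟨i.2, hi⟩]

variable [Field K] [Field L] [Field M] [Fintype K] [Algebra K L] [Algebra L M] [Algebra K M]

/-- The accepted transcripts of a list of calls, with the numbers of their sessions. -/
def knowledge (D : PublicData P K L M) (h : List (Call P L M)) : Set (ℕ × Transcript P L M) :=
  {p | p.2.Accepted D ∧ ∃ C ∈ h, C.session = p.1 ∧ C.T = p.2}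

theorem knowledge_append_of_accepted (D : PublicData P K L M) (h : List (Call P L M))
    {C : Call P L M} (hC : C.T.Accepted D) :
    knowledge D (h ++ [C]) = insert (C.session, C.T) (knowledge D h) := by
  ext ⟨s, T⟩
  simp only [knowledge, List.mem_append, List.mem_singleton, Set.mem_ofPred_eq, Set.mem_insert_iff,
    Prod.mk.injEq]
  constructor
  · rintro ⟨ha, C', h' | rfl, rfl, rfl⟩
    · exact Or.inr ⟨ha, C', h', rfl, rfl⟩
    · exact Or.inl ⟨rfl, rfl⟩
  · rintro (⟨rfl, rfl⟩ | ⟨ha, C', h', e⟩)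
    · exact ⟨hC, C, Or.inr rfl, rfl, rfl⟩
    · exact ⟨ha, C', Or.inl h', e⟩

theorem knowledge_append_of_not_accepted (D : PublicData P K L M) (h : List (Call P L M))
    {C : Call P L M} (hC : ¬ C.T.Accepted D) : knowledge D (h ++ [C]) = knowledge D h := by
  ext ⟨s, T⟩
  simp only [knowledge, List.mem_append, List.mem_singleton, Set.mem_ofPred_eq]
  constructor
  · rintro ⟨ha, C', h' | rfl, rfl, rfl⟩
    · exact ⟨ha, C', h', rfl, rfl⟩
    · exact absurd ha hC
  · rintro ⟨ha, C', h', e⟩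
    exact ⟨ha, C', Or.inl h', e⟩

/-- The output is read off from the accepted transcripts `κ`: the counterpart of `Output.ReadOff`
in terms of `knowledge`. -/
def Output.ReadFrom (D : PublicData P K L M) (κ : Set (ℕ × Transcript P L M)) :
    Output P L M → Prop
  | .comCollision m m' ρ ρ' => ∀ o ∈ [(m, ρ), (m', ρ')], ∃ p ∈ κ, ∃ i, p.2.rsp₂.opening i = o
  | .merkleCollision u u' => ∀ w ∈ [u, u'], ∃ p ∈ κ,
      w ∈ rebuildInputs D.hashM (p.2.leaf D) p.2.rsp₂.auth 0 P.N
  | .hashCollision b b' => ∀ w ∈ [b, b'], ∃ p ∈ κ, p.2.HashInput D w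
  | .witness x => ∃ (s : ℕ) (J : Finset (Fin P.N)) (st : Fin P.N → State P L M),
      J.card = P.ℓ + 1 ∧ (∀ i ∈ J, Opened κ s i (st i)) ∧
      x = fullVec D 1 (D.lsss.reconstructVec J fun i => (st i).xB)

theorem Output.ReadFrom.readOff {D : PublicData P K L M} {h : List (Call P L M)}
    {o : Output P L M} (ho : o.ReadFrom D (knowledge D h)) : o.ReadOff D h := by
  cases o with
  | witness x =>
    obtain ⟨s, J, st, hJ, hop, hx⟩ := ho
    refine ⟨s, J, st, hJ, fun i hi => ?_, hx⟩
    obtain ⟨T, ⟨ha, C, hC, hs, rfl⟩, hT⟩ := hop i hi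
    exact ⟨C, hC, hs, ha, hT⟩
  | _ =>
    intro w hw
    obtain ⟨_, ⟨ha, C, hC, -, e⟩, hp⟩ := ho w hw
    exact ⟨C, hC, e ▸ ha, e ▸ hp⟩

/-- A valid output can be read off from the accepted transcripts `κ`. -/
def Found [Module.Finite K L] (D : PublicData P K L M) (κ : Set (ℕ × Transcript P L M)) : Prop :=
  ∃ o : Output P L M, o.Valid D ∧ o.ReadFrom D κ

/-- All transcripts of `κ` are accepted, and those of one session have the same commitment, as is
the case for the transcripts that an extractor sees. -/
structure Coherent (D : PublicData P K L M) (κ : Set (ℕ × Transcript P L M)) : Prop where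
  accepted : ∀ p ∈ κ, p.2.Accepted D
  root_eq : ∀ p ∈ κ, ∀ p' ∈ κ, p.1 = p'.1 → p.2.h₀ = p'.2.h₀

variable {D : PublicData P K L M} {κ : Set (ℕ × Transcript P L M)} {s : ℕ}

theorem Coherent.insert (hκ : Coherent D κ) {T T₀ : Transcript P L M} (hT₀ : (s, T₀) ∈ κ)
    (hT : T.Accepted D) (h : T.h₀ = T₀.h₀) : Coherent D (insert (s, T) κ) where
  accepted := by
    rintro p (rfl | hp)
    · exact hT
    · exact hκ.accepted p hp
  root_eq := by
    rintro p (rfl | hp) p' (rfl | hp') hs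
    · rfl
    · exact h.trans (hκ.root_eq _ hT₀ _ hp' hs)
    · exact (hκ.root_eq _ hp _ hT₀ hs).trans h.symm
    · exact hκ.root_eq _ hp _ hp' hs

variable [Module.Finite K L]

theorem Opened.unique (hκ : Coherent D κ) (hf : ¬ Found D κ) {i : Fin P.N} {m m' : State P L M}
    (h : Opened κ s i m) (h' : Opened κ s i m') : m = m' := by
  by_contra hne
  obtain ⟨T, hT, hi, rfl⟩ := h
  obtain ⟨T', hT', hi', rfl⟩ := h'
  by_cases hcom : D.com (T.rsp₂.opening ⟨i, hi⟩).1 (T.rsp₂.opening ⟨i, hi⟩).2 =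
      D.com (T'.rsp₂.opening ⟨i, hi'⟩).1 (T'.rsp₂.opening ⟨i, hi'⟩).2
  · refine hf ⟨.comCollision _ _ _ _, ⟨hne, hcom⟩, ?_⟩
    simp only [Output.ReadFrom, List.mem_cons, List.not_mem_nil, or_false]
    rintro o (rfl | rfl)
    exacts [⟨_, hT, ⟨i, hi⟩, rfl⟩, ⟨_, hT', ⟨i, hi'⟩, rfl⟩]
  · have hroot : rebuild D.hashM (T.leaf D) T.rsp₂.auth 0 P.N =
        rebuild D.hashM (T'.leaf D) T'.rsp₂.auth 0 P.N :=
      (hκ.accepted _ hT).1.trans ((hκ.root_eq _ hT _ hT' rfl).trans (hκ.accepted _ hT').1.symm)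
    obtain ⟨u, hu, u', hu', hv⟩ := exists_collision_of_rebuild_eq D.hashM _ _ _ _
      (T.leaf_eq D hi) (T'.leaf_eq D hi') hcom P.N 0 (Nat.zero_le _) (by simp) hroot
    refine hf ⟨.merkleCollision u u', hv, ?_⟩
    simp only [Output.ReadFrom, List.mem_cons, List.not_mem_nil, or_false]
    rintro o (rfl | rfl)
    exacts [⟨_, hT, hu⟩, ⟨_, hT', hu'⟩]

theorem hashInput_eq_of_not_found (hf : ¬ Found D κ) {s' : ℕ} {T T' : Transcript P L M}
    (hT : (s, T) ∈ κ) (hT' : (s', T') ∈ κ) {b b' : Broadcast P M} (hb : T.HashInput D b)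
    (hb' : T'.HashInput D b') (h : D.hash b = D.hash b') : b = b' := by
  by_contra hne
  refine hf ⟨.hashCollision _ _, ⟨hne, h⟩, ?_⟩
  simp only [Output.ReadFrom, List.mem_cons, List.not_mem_nil, or_false]
  rintro o (rfl | rfl)
  exacts [⟨_, hT, hb⟩, ⟨_, hT', hb'⟩]

theorem not_rankWeight_le_of_not_found (hf : ¬ Found D κ) {J : Finset (Fin P.N)}
    (hJ : J.card = P.ℓ + 1) {st : Fin P.N → State P L M} (hst : ∀ i ∈ J, Opened κ s i (st i)) :
    ¬ rankWeight K (fullVec D (1 : K) (reconstructState D J st).xB) ≤ P.r := by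
  intro hr
  refine hf ⟨.witness _, ⟨?_, hr⟩, s, J, st, hJ, hst, rfl⟩
  simp [fullVec, Matrix.fromCols_mulVec]

/-- The accepted transcript `T` of session `s` gives an output or opens a new party. -/
def Progress (D : PublicData P K L M) (κ : Set (ℕ × Transcript P L M)) (s : ℕ)
    (T : Transcript P L M) : Prop :=
  Found D (insert (s, T) κ) ∨
    (openedParties κ s).card < (openedParties (insert (s, T) κ) s).card

end Knowledge

/-! ### Accepted second challenges without progress -/

section NoProgress

variable {P : Params} {K L M : Type*} [Field K] [Field L] [Field M] [Fintype K] [Algebra K L]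
  [Algebra L M] [Algebra K M] {D : PublicData P K L M} {κ : Set (ℕ × Transcript P L M)} {s : ℕ}

theorem Transcript.Recovers.eq_of_broadcast_eq {T T' : Transcript P L M}
    {α₀ α₀' : Fin (P.r - 1) → M} {α α' : Fin P.N → Fin (P.r - 1) → M} {v v' : Fin P.N → M}
    (hr : T.Recovers D α₀ α v) (hr' : T'.Recovers D α₀' α' v') {S : Finset (Fin P.N)}
    (hS : S.card = P.ℓ + 1)
    (h : (fun j => (α (S.orderEmbOfFin hS j), v (S.orderEmbOfFin hS j))) =
      fun j => (α' (S.orderEmbOfFin hS j), v' (S.orderEmbOfFin hS j))) :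
    α₀ = α₀' ∧ α = α' ∧ v = v' := by
  have heq (i : Fin P.N) (hi : i ∈ S) : α i = α' i ∧ v i = v' i := by
    obtain ⟨j, rfl⟩ : i ∈ Set.range (S.orderEmbOfFin hS) := by
      rw [Finset.range_orderEmbOfFin]
      exact hi
    simpa using congrFun h j
  obtain ⟨h₀, hα⟩ := hr.1.eq_of_eqOn hr'.1 hS fun i hi => (heq i hi).1
  obtain ⟨-, hv⟩ := hr.2.1.eq_of_eqOn hr'.2.1 hS fun i hi => (heq i hi).2
  exact ⟨h₀, hα, hv⟩

open Classical in
/-- The parties opened in session `s` whose states yield their shares of `α` and `v` under the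
first challenge `ch`. -/
def consistentParties (D : PublicData P K L M) (κ : Set (ℕ × Transcript P L M)) (s : ℕ)
    (ch : Challenge₁ P M) (α₀ : Fin (P.r - 1) → M) (α : Fin P.N → Fin (P.r - 1) → M)
    (v : Fin P.N → M) : Finset (Fin P.N) :=
  (openedParties κ s).filter fun i => α i = partyα D ch i (openedState κ s i) ∧
    v i = partyV D ch α₀ i (openedState κ s i)

theorem subset_consistentParties_of_not_progress [Module.Finite K L] (hκ : Coherent D κ)
    {Q : Prover P L M} {ω : Q.Tape} {c : Challenge₁ P M} {I₀ I : Challenge₂ P}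
    (hT₀ : (s, Q.transcript ω c I₀) ∈ κ) {α₀ : Fin (P.r - 1) → M}
    {α : Fin P.N → Fin (P.r - 1) → M} {v : Fin P.N → M}
    (hr : (Q.transcript ω c I₀).Recovers D α₀ α v)
    (hb : D.hash (fun j =>
      (α ((Q.respond₁ ω c).S.1.orderEmbOfFin (Q.respond₁ ω c).S.2 j),
        v ((Q.respond₁ ω c).S.1.orderEmbOfFin (Q.respond₁ ω c).S.2 j))) = (Q.respond₁ ω c).h₁)
    (hacc : (Q.transcript ω c I).Accepted D) (hnp : ¬ Progress D κ s (Q.transcript ω c I)) :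
    I.1 ⊆ consistentParties D κ s c α₀ α v := by
  classical
  intro i hi
  rw [Progress, not_or, not_lt] at hnp
  obtain ⟨hnf, hcard⟩ := hnp
  set T := Q.transcript ω c I
  have hκ' := hκ.insert hT₀ hacc rfl
  have hsub : κ ⊆ insert (s, T) κ := Set.subset_insert _ _
  have hopened : openedParties κ s = openedParties (insert (s, T) κ) s :=
    Finset.eq_of_subset_of_card_le (openedParties_mono hsub s) hcard
  have hop : Opened (insert (s, T) κ) s i (T.rsp₂.opening ⟨i, hi⟩).1 :=
    ⟨T, Or.inl rfl, hi, rfl⟩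
  have hiR : i ∈ openedParties κ s := hopened ▸ mem_openedParties.2 ⟨_, hop⟩
  have hstate : (T.rsp₂.opening ⟨i, hi⟩).1 = openedState κ s i :=
    hop.unique hκ' hnf ((opened_openedState hiR).mono hsub)
  obtain ⟨-, -, -, b', ⟨α₀', α', v', hr', rfl⟩, hb'⟩ := hacc
  have hbroadcast := hashInput_eq_of_not_found hnf (Or.inr hT₀) (Or.inl rfl)
    ⟨α₀, α, v, hr, rfl⟩ ⟨α₀', α', v', hr', rfl⟩ (hb.trans hb'.symm)
  obtain ⟨rfl, rfl, rfl⟩ := hr.eq_of_broadcast_eq hr' (Q.respond₁ ω c).S.2 hbroadcast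
  refine Finset.mem_filter.2 ⟨hiR, ?_, ?_⟩
  · exact hstate ▸ hr'.2.2.1 ⟨i, hi⟩
  · exact hstate ▸ hr'.2.2.2.2 ⟨i, hi⟩

theorem card_le_of_forall_subset {𝓘 : Finset (Challenge₂ P)} {G : Finset (Fin P.N)}
    (h : ∀ I ∈ 𝓘, I.1 ⊆ G) : 𝓘.card ≤ 1 + P.ℓ * (G.powersetCard (P.ℓ + 1)).card := by
  classical
  calc 𝓘.card = (𝓘.image Subtype.val).card :=
        (Finset.card_image_of_injective _ Subtype.val_injective).symm
    _ ≤ (G.powersetCard P.ℓ).card := by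
        refine Finset.card_le_card fun I hI => ?_
        obtain ⟨I, hI', rfl⟩ := Finset.mem_image.1 hI
        exact Finset.mem_powersetCard.2 ⟨h I hI', I.2⟩
    _ ≤ 1 + P.ℓ * (G.powersetCard (P.ℓ + 1)).card := by
        rw [Finset.card_powersetCard, Finset.card_powersetCard]
        exact choose_le_one_add_mul_choose_succ _ _

theorem choose_mul_soundnessError (P : Params) (p : ℝ) :
    (P.N.choose P.ℓ : ℝ) * soundnessError P.N P.ℓ p =
      1 + P.ℓ * (p * P.N.choose (P.ℓ + 1)) := by
  have hmul : (P.N.choose (P.ℓ + 1) : ℝ) * (P.ℓ + 1) = P.N.choose P.ℓ * ((P.N : ℝ) - P.ℓ) := by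
    rw [← Nat.cast_sub P.ℓ_lt_N.le]
    exact_mod_cast Nat.choose_succ_right_eq P.N P.ℓ
  have hC : (P.N.choose P.ℓ : ℝ) ≠ 0 := by
    exact_mod_cast (Nat.choose_pos P.ℓ_lt_N.le).ne'
  have hl : (P.ℓ : ℝ) + 1 ≠ 0 := by positivity
  rw [soundnessError]
  field_simp
  linear_combination (-(p * P.ℓ)) * hmul

variable [IsScalarTower K L M]

open Classical in
/-- The sets of `ℓ + 1` parties opened in session `s` whose reconstructed state passes the
multi-party computation. -/
def falsePositives (D : PublicData P K L M) (κ : Set (ℕ × Transcript P L M)) (s : ℕ)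
    (ch : Challenge₁ P M) : Finset (Finset (Fin P.N)) :=
  ((openedParties κ s).powersetCard (P.ℓ + 1)).filter
    fun J => MpcAccepts D (reconstructState D J (openedState κ s)) ch

theorem powersetCard_consistentParties_subset {T : Transcript P L M} {α₀ : Fin (P.r - 1) → M}
    {α : Fin P.N → Fin (P.r - 1) → M} {v : Fin P.N → M} (hr : T.Recovers D α₀ α v)
    (ch : Challenge₁ P M) :
    (consistentParties D κ s ch α₀ α v).powersetCard (P.ℓ + 1) ⊆ falsePositives D κ s ch := by
  classical
  intro J hJ
  obtain ⟨hJG, hJ⟩ := Finset.mem_powersetCard.1 hJ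
  refine Finset.mem_filter.2 ⟨Finset.mem_powersetCard.2
    ⟨hJG.trans (Finset.filter_subset _ _), hJ⟩, ?_⟩
  exact mpcAccepts_reconstructState D hJ (openedState κ s) ch hr.1 hr.2.1
    (fun i hi => (Finset.mem_filter.1 (hJG hi)).2.1)
    (fun i hi => (Finset.mem_filter.1 (hJG hi)).2.2)

variable [Module.Finite K L]

theorem card_not_progress_le (hκ : Coherent D κ) {Q : Prover P L M} {ω : Q.Tape}
    {c : Challenge₁ P M} {I₀ : Challenge₂ P} (hT₀ : (s, Q.transcript ω c I₀) ∈ κ)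
    {𝓘 : Finset (Challenge₂ P)} (h𝓘 : ∀ I ∈ 𝓘, (Q.transcript ω c I).Accepted D ∧
      ¬ Progress D κ s (Q.transcript ω c I)) :
    𝓘.card ≤ 1 + P.ℓ * (falsePositives D κ s c).card := by
  obtain ⟨-, -, -, b, ⟨α₀, α, v, hr, rfl⟩, hb⟩ := hκ.accepted _ hT₀
  refine (card_le_of_forall_subset fun I hI => subset_consistentParties_of_not_progress hκ hT₀ hr
    hb (h𝓘 I hI).1 (h𝓘 I hI).2).trans ?_
  gcongr
  exact powersetCard_consistentParties_subset hr c

theorem sum_card_falsePositives_le [Fintype M] (hf : ¬ Found D κ) :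
    ∑ ch : Challenge₁ P M, ((falsePositives D κ s ch).card : ℝ) ≤
      P.N.choose (P.ℓ + 1) * (falsePositiveRate K L M * Fintype.card (Challenge₁ P M)) := by
  classical
  have hp0 : 0 ≤ falsePositiveRate K L M := falsePositiveRate_nonneg
  calc ∑ ch : Challenge₁ P M, ((falsePositives D κ s ch).card : ℝ)
      = ∑ J ∈ (openedParties κ s).powersetCard (P.ℓ + 1), ((Finset.univ.filter
          fun ch : Challenge₁ P M =>
            MpcAccepts D (reconstructState D J (openedState κ s)) ch).card : ℝ) := by
        simp only [falsePositives, Finset.card_filter, Nat.cast_sum]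
        rw [Finset.sum_comm]
    _ ≤ ((openedParties κ s).powersetCard (P.ℓ + 1)).card •
          (falsePositiveRate K L M * Fintype.card (Challenge₁ P M)) := by
        refine Finset.sum_le_card_nsmul _ _ _ fun J hJ => ?_
        obtain ⟨hJR, hJ⟩ := Finset.mem_powersetCard.1 hJ
        exact card_mpcAccepts_le D _ (not_rankWeight_le_of_not_found hf hJ fun i hi =>
          opened_openedState (hJR hi))
    _ ≤ _ := by
        rw [nsmul_eq_mul, Finset.card_powersetCard]
        gcongr
        exact (Finset.card_le_univ _).trans_eq (by simp)

theorem sum_one_add_card_falsePositives_le [Fintype M] (hf : ¬ Found D κ) :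
    ∑ ch : Challenge₁ P M, (1 + (P.ℓ : ℝ) * (falsePositives D κ s ch).card) ≤
      Fintype.card (Challenge₁ P M) *
        (P.N.choose P.ℓ * soundnessError P.N P.ℓ (falsePositiveRate K L M)) := by
  rw [choose_mul_soundnessError, Finset.sum_add_distrib, ← Finset.mul_sum, Finset.sum_const,
    Finset.card_univ, nsmul_eq_mul, mul_one, mul_add, mul_one]
  have := mul_le_mul_of_nonneg_left (sum_card_falsePositives_le (s := s) hf)
    (Nat.cast_nonneg (α := ℝ) P.ℓ)
  linarith

end NoProgress

/-! ### Expectations of discrete distributions -/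

section Mean

variable {α β : Type*}

/-- The expectation of `f` under `p`. -/
def mean (p : PMF α) (f : α → ℝ≥0∞) : ℝ≥0∞ := ∑' a, p a * f a

theorem mean_pure (a : α) (f : α → ℝ≥0∞) : mean (PMF.pure a) f = f a := by
  rw [mean, tsum_eq_single a fun b hb => by rw [PMF.pure_apply_of_ne _ _ hb, zero_mul],
    PMF.pure_apply_self, one_mul]

theorem mean_bind (p : PMF α) (q : α → PMF β) (f : β → ℝ≥0∞) :
    mean (p.bind q) f = mean p fun a => mean (q a) f := by
  simp only [mean, PMF.bind_apply, ← ENNReal.tsum_mul_left, ← ENNReal.tsum_mul_right]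
  rw [ENNReal.tsum_comm]
  simp only [mul_assoc]

theorem mean_map (p : PMF α) (g : α → β) (f : β → ℝ≥0∞) :
    mean (p.map g) f = mean p fun a => f (g a) := by
  rw [← PMF.bind_pure_comp, mean_bind]
  simp only [Function.comp, mean_pure]

theorem mean_mono {p : PMF α} {f g : α → ℝ≥0∞} (h : ∀ a ∈ p.support, f a ≤ g a) :
    mean p f ≤ mean p g := by
  refine ENNReal.tsum_le_tsum fun a => ?_
  by_cases ha : p a = 0
  · simp [ha]
  · exact mul_le_mul_right (h a ((PMF.mem_support_iff p a).2 ha)) _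

theorem mean_add (p : PMF α) (f g : α → ℝ≥0∞) :
    mean p (fun a => f a + g a) = mean p f + mean p g := by
  simp only [mean, mul_add, ENNReal.tsum_add]

theorem toOuterMeasure_eq_mean (p : PMF α) (s : Set α) :
    p.toOuterMeasure s = mean p (s.indicator 1) := by
  rw [PMF.toOuterMeasure_apply, mean]
  refine tsum_congr fun a => ?_
  by_cases ha : a ∈ s <;> simp [ha]

theorem mean_uniformOfFintype_ofReal [Fintype α] [Nonempty α] {f : α → ℝ} (hf : ∀ a, 0 ≤ f a) :
    mean (PMF.uniformOfFintype α) (fun a => ENNReal.ofReal (f a)) =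
      ENNReal.ofReal (𝔼 a, f a) := by
  have hcard : (0 : ℝ) < Fintype.card α := by exact_mod_cast Fintype.card_pos
  rw [mean, tsum_fintype, Fintype.expect_eq_sum_div_card, div_eq_inv_mul,
    ENNReal.ofReal_mul (by positivity), ENNReal.ofReal_inv_of_pos hcard, ENNReal.ofReal_natCast,
    ENNReal.ofReal_sum_of_nonneg fun a _ => hf a, Finset.mul_sum]
  simp only [PMF.uniformOfFintype_apply]

theorem mean_uniformOfFintype_le [Fintype α] [Nonempty α] {F : α → ℝ≥0∞} {f : α → ℝ}
    (hf : ∀ a, 0 ≤ f a) (h : ∀ a, F a ≤ ENNReal.ofReal (f a)) :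
    mean (PMF.uniformOfFintype α) F ≤ ENNReal.ofReal (𝔼 a, f a) :=
  (mean_mono fun a _ => h a).trans_eq (mean_uniformOfFintype_ofReal hf)

/-- A coin that shows `true` with probability `p`. -/
def coin (p : unitInterval) : PMF Bool :=
  PMF.ofFintype (fun b => ENNReal.ofReal (bif b then p else 1 - p)) (by
    rw [Fintype.sum_bool, cond_true, cond_false,
      ← ENNReal.ofReal_add p.2.1 (sub_nonneg.2 p.2.2), add_sub_cancel, ENNReal.ofReal_one])

theorem mean_coin (p : unitInterval) (f : Bool → ℝ≥0∞) :
    mean (coin p) f = ENNReal.ofReal p * f true + ENNReal.ofReal (1 - p) * f false := by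
  rw [mean, tsum_fintype, Fintype.sum_bool]
  rfl

theorem expect_ite_ite [Fintype α] [Nonempty α] [DecidableEq α] (S : Finset α) (q : α → Prop)
    [DecidablePred q] (x y z : ℝ) :
    𝔼 a, (if a ∈ S then if q a then x else y else z) =
      (1 - (S.card : ℝ) / Fintype.card α) * z + (S.card : ℝ) / Fintype.card α *
        ((1 - ((S.filter q).card : ℝ) / S.card) * y + ((S.filter q).card : ℝ) / S.card * x) := by
  have hcard : (Fintype.card α : ℝ) ≠ 0 := by exact_mod_cast Fintype.card_ne_zero
  have hpt (a : α) : (if a ∈ S then if q a then x else y else z) =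
      z + ((if a ∈ S then y - z else 0) + if a ∈ S.filter q then x - y else 0) := by
    by_cases hS : a ∈ S <;> by_cases hq : q a <;> simp [hS, hq]
  have hS : (S.card : ℝ) * (((S.filter q).card : ℝ) / S.card) = (S.filter q).card := by
    refine mul_div_cancel_of_imp' fun h => ?_
    rw [Nat.cast_eq_zero, Finset.card_eq_zero] at h
    simp [h]
  rw [Finset.expect_congr rfl fun a _ => hpt a, Fintype.expect_eq_sum_div_card,
    Finset.sum_add_distrib, Finset.sum_add_distrib, Finset.sum_ite_mem, Finset.sum_ite_mem,
    Finset.univ_inter, Finset.univ_inter, Finset.sum_const, Finset.sum_const, Finset.sum_const,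
    Finset.card_univ, nsmul_eq_mul, nsmul_eq_mul, nsmul_eq_mul]
  field_simp
  linear_combination (y - x) * hS

theorem expect_ite_mem [Fintype α] [Nonempty α] [DecidableEq α] (S : Finset α) (x z : ℝ) :
    𝔼 a, (if a ∈ S then x else z) =
      (1 - (S.card : ℝ) / Fintype.card α) * z + (S.card : ℝ) / Fintype.card α * x := by
  have h := expect_ite_ite S (fun _ => True) x x z
  simp only [ite_self] at h
  rw [h]
  ring

end Mean

/-! ### Bounding the number of calls by a potential -/

section Drift

variable {P : Params} {L M : Type*} [Field M] [Fintype M]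

theorem Extractor.inv_of_mem_support_run (E : Extractor P L M) (Q : Prover P L M)
    {Inv : List (Q.Tape × Call P L M) → Prop} (h0 : Inv [])
    (hstep : ∀ h, Inv h → ∀ μ ∈ (E.next (h.map Prod.snd)).support,
      ∀ x ∈ (Q.move h μ.1 μ.2).support, Inv (h ++ [x])) (t : ℕ) :
    ∀ h ∈ (E.run Q t).support, Inv h := by
  induction t with
  | zero =>
    intro h hh
    rw [Extractor.run, PMF.support_pure, Set.mem_singleton_iff] at hh
    exact hh ▸ h0
  | succ t ih =>
    intro h hh
    rw [Extractor.run, PMF.mem_support_bind_iff] at hh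
    obtain ⟨h', hh', hh⟩ := hh
    cases hout : E.out (h'.map Prod.snd) with
    | some o =>
      rw [hout] at hh
      rw [PMF.support_pure, Set.mem_singleton_iff] at hh
      exact hh ▸ ih h' hh'
    | none =>
      rw [hout] at hh
      simp only [PMF.mem_support_bind_iff, PMF.mem_support_map_iff] at hh
      obtain ⟨μ, hμ, x, hx, rfl⟩ := hh
      exact hstep h' (ih h' hh') μ hμ x hx

theorem Extractor.toOuterMeasure_add_mean_run_succ_le (E : Extractor P L M) (Q : Prover P L M)
    {V : List (Q.Tape × Call P L M) → ℝ≥0∞} {t : ℕ}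
    (hdrift : ∀ h ∈ (E.run Q t).support, E.out (h.map Prod.snd) = none →
      1 + mean (E.next (h.map Prod.snd))
        (fun μ => mean (Q.move h μ.1 μ.2) fun x => V (h ++ [x])) ≤ V h) :
    (E.run Q t).toOuterMeasure {h | E.out (h.map Prod.snd) = none} +
      mean (E.run Q (t + 1)) V ≤ mean (E.run Q t) V := by
  rw [toOuterMeasure_eq_mean, Extractor.run, mean_bind, ← mean_add]
  refine mean_mono fun h hh => ?_
  cases hout : E.out (h.map Prod.snd) with
  | some o =>
    have hmem : h ∉ {h : List (Q.Tape × Call P L M) | E.out (h.map Prod.snd) = none} := by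
      simp [hout]
    rw [Set.indicator_of_notMem hmem, zero_add]
    simp only [mean_pure, le_refl]
  | none =>
    have hmem : h ∈ {h : List (Q.Tape × Call P L M) | E.out (h.map Prod.snd) = none} := hout
    rw [Set.indicator_of_mem hmem, Pi.one_apply]
    simp only [mean_bind, mean_map]
    exact hdrift h hh hout

theorem Extractor.expectedCalls_le (E : Extractor P L M) (Q : Prover P L M)
    (V : List (Q.Tape × Call P L M) → ℝ≥0∞) (Inv : List (Q.Tape × Call P L M) → Prop)
    (h0 : Inv [])
    (hstep : ∀ h, Inv h → ∀ μ ∈ (E.next (h.map Prod.snd)).support,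
      ∀ x ∈ (Q.move h μ.1 μ.2).support, Inv (h ++ [x]))
    (hdrift : ∀ h, Inv h → E.out (h.map Prod.snd) = none →
      1 + mean (E.next (h.map Prod.snd))
        (fun μ => mean (Q.move h μ.1 μ.2) fun x => V (h ++ [x])) ≤ V h) :
    E.expectedCalls Q ≤ V [] := by
  have hrun (t : ℕ) := E.toOuterMeasure_add_mean_run_succ_le Q fun h hh =>
    hdrift h (E.inv_of_mem_support_run Q h0 hstep t h hh)
  have hsum (n : ℕ) : ∑ t ∈ Finset.range n,
      (E.run Q t).toOuterMeasure {h | E.out (h.map Prod.snd) = none} + mean (E.run Q n) V ≤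
        V [] := by
    induction n with
    | zero => simp [Extractor.run, mean_pure]
    | succ n ih =>
      rw [Finset.sum_range_succ, add_assoc]
      exact (add_le_add_right (hrun n) _).trans ih
  exact ENNReal.tsum_le_of_sum_range_le fun n => le_self_add.trans (hsum n)

end Drift

/-! ### The possible results of a call -/

section Calls

variable {P : Params} {L M : Type*} [Field M] [Fintype M]

theorem mem_support_call {Q : Prover P L M} {ω : Q.Tape} {s a : ℕ}
    {c? : Option (Challenge₁ P M)} {x : Q.Tape × Call P L M}
    (hx : x ∈ (Q.call ω s a c?).support) :
    ∃ c I, x = (ω, ⟨s, a, Q.transcript ω c I⟩) ∧ ∀ c' ∈ c?, c = c' := by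
  rw [Prover.call, PMF.mem_support_bind_iff] at hx
  obtain ⟨c, hc, hx⟩ := hx
  rw [PMF.mem_support_map_iff] at hx
  obtain ⟨I, -, rfl⟩ := hx
  refine ⟨c, I, rfl, fun c' hc' => ?_⟩
  rw [Option.mem_def] at hc'
  subst hc'
  simpa using hc

theorem mem_support_freshCall {Q : Prover P L M} {s a : ℕ} {x : Q.Tape × Call P L M}
    (hx : x ∈ (Q.freshCall s a).support) : ∃ ω c I, x = (ω, ⟨s, a, Q.transcript ω c I⟩) := by
  rw [Prover.freshCall, PMF.mem_support_bind_iff] at hx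
  obtain ⟨ω, -, hx⟩ := hx
  obtain ⟨c, I, rfl, -⟩ := mem_support_call hx
  exact ⟨ω, c, I, rfl⟩

theorem mean_call_none_le (Q : Prover P L M) (ω : Q.Tape) (s a : ℕ)
    {F : Q.Tape × Call P L M → ℝ≥0∞} {f : Challenge₁ P M → Challenge₂ P → ℝ}
    (hf : ∀ c I, 0 ≤ f c I)
    (h : ∀ c I, F (ω, ⟨s, a, Q.transcript ω c I⟩) ≤ ENNReal.ofReal (f c I)) :
    mean (Q.call ω s a none) F ≤ ENNReal.ofReal (𝔼 c, 𝔼 I, f c I) := by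
  rw [Prover.call, mean_bind]
  refine mean_uniformOfFintype_le (fun c => Finset.expect_nonneg fun I _ => hf c I) fun c => ?_
  rw [mean_map]
  exact mean_uniformOfFintype_le (hf c) (h c)

theorem mean_call_some_le (Q : Prover P L M) (ω : Q.Tape) (s a : ℕ) (c : Challenge₁ P M)
    {F : Q.Tape × Call P L M → ℝ≥0∞} {f : Challenge₂ P → ℝ} (hf : ∀ I, 0 ≤ f I)
    (h : ∀ I, F (ω, ⟨s, a, Q.transcript ω c I⟩) ≤ ENNReal.ofReal (f I)) :
    mean (Q.call ω s a (some c)) F ≤ ENNReal.ofReal (𝔼 I, f I) := by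
  rw [Prover.call, mean_bind, Option.elim_some, mean_pure, mean_map]
  exact mean_uniformOfFintype_le hf h

theorem move_rewindCommit_last (Q : Prover P L M) (h : List (Q.Tape × Call P L M))
    (y : Q.Tape × Call P L M) (a : ℕ) :
    Q.move (h ++ [y]) a (.rewindCommit ((h ++ [y]).length - 1)) =
      Q.call y.1 y.2.session a none := by
  simp [Prover.move]

theorem move_rewindResponse_last (Q : Prover P L M) (h : List (Q.Tape × Call P L M))
    (y : Q.Tape × Call P L M) (a : ℕ) :
    Q.move (h ++ [y]) a (.rewindResponse ((h ++ [y]).length - 1)) =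
      Q.call y.1 y.2.session a (some y.2.T.ch₁) := by
  simp [Prover.move]

end Calls

/-! ### Acceptance probabilities -/

section Probabilities

variable {P : Params} {K L M : Type*} [Field K] [Field L] [Field M] [Fintype K] [Algebra K L]
  [Algebra L M] [Algebra K M] (D : PublicData P K L M) (Q : Prover P L M)

open Classical in
/-- The second challenges that are accepted on tape `ω` after the first challenge `c`. -/
def Prover.acceptedSet (ω : Q.Tape) (c : Challenge₁ P M) : Finset (Challenge₂ P) :=
  Finset.univ.filter fun I => (Q.transcript ω c I).Accepted D

/-- The acceptance probability on tape `ω` after the first challenge `c`. -/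
def Prover.acceptProb₁ (ω : Q.Tape) (c : Challenge₁ P M) : ℝ :=
  (Q.acceptedSet D ω c).card / Fintype.card (Challenge₂ P)

/-- The acceptance probability on tape `ω`. -/
def Prover.tapeProb [Fintype M] (ω : Q.Tape) : ℝ :=
  𝔼 c, Q.acceptProb₁ D ω c

variable (ω : Q.Tape) (c : Challenge₁ P M)

theorem Prover.mem_acceptedSet {I : Challenge₂ P} :
    I ∈ Q.acceptedSet D ω c ↔ (Q.transcript ω c I).Accepted D := by
  simp [Prover.acceptedSet]

theorem Prover.acceptProb₁_nonneg : 0 ≤ Q.acceptProb₁ D ω c := by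
  unfold Prover.acceptProb₁
  positivity

theorem Prover.acceptProb₁_le_one : Q.acceptProb₁ D ω c ≤ 1 :=
  div_le_one_of_le₀ (by exact_mod_cast Finset.card_le_univ _) (Nat.cast_nonneg _)

theorem Prover.acceptProb₁_sub_le {m : ℝ} (hm : 0 ≤ m) :
    Q.acceptProb₁ D ω c - m / Fintype.card (Challenge₂ P) ≤
      Q.acceptProb₁ D ω c * max (1 - m / (Q.acceptedSet D ω c).card) 0 := by
  rcases Nat.eq_zero_or_pos (Q.acceptedSet D ω c).card with h | h
  · have hp : Q.acceptProb₁ D ω c = 0 := by simp [Prover.acceptProb₁, h]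
    rw [hp, zero_mul, zero_sub, neg_nonpos]
    exact div_nonneg hm (Nat.cast_nonneg _)
  · have h' : (0 : ℝ) < (Q.acceptedSet D ω c).card := by exact_mod_cast h
    calc Q.acceptProb₁ D ω c - m / Fintype.card (Challenge₂ P)
        = Q.acceptProb₁ D ω c * (1 - m / (Q.acceptedSet D ω c).card) := by
          rw [Prover.acceptProb₁]
          field_simp
      _ ≤ _ := mul_le_mul_of_nonneg_left (le_max_left _ _) (Q.acceptProb₁_nonneg D ω c)

theorem Prover.tapeProb_nonneg [Fintype M] : 0 ≤ Q.tapeProb D ω :=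
  Finset.expect_nonneg fun c _ => Q.acceptProb₁_nonneg D ω c

theorem Prover.tapeProb_le_one [Fintype M] : Q.tapeProb D ω ≤ 1 :=
  Finset.expect_le Finset.univ_nonempty fun c _ => Q.acceptProb₁_le_one D ω c

theorem Prover.mean_accepted :
    mean (PMF.uniformOfFintype (Challenge₂ P))
      (fun I => {T : Transcript P L M | T.Accepted D}.indicator 1 (Q.transcript ω c I)) =
      ENNReal.ofReal (Q.acceptProb₁ D ω c) := by
  have h : ∀ I, {T : Transcript P L M | T.Accepted D}.indicator 1 (Q.transcript ω c I) =
      ENNReal.ofReal (if I ∈ Q.acceptedSet D ω c then 1 else 0) := fun I => by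
    by_cases hI : (Q.transcript ω c I).Accepted D <;> simp [Prover.mem_acceptedSet, hI]
  simp only [h]
  rw [mean_uniformOfFintype_ofReal fun I => by split_ifs <;> norm_num, expect_ite_mem, mul_zero,
    zero_add, mul_one, Prover.acceptProb₁]

theorem Prover.acceptProb_eq [Fintype M] : Q.acceptProb D = 𝔼 ω, Q.tapeProb D ω := by
  rw [Prover.acceptProb, toOuterMeasure_eq_mean, Prover.execution]
  simp only [mean_bind, mean_map, Prover.mean_accepted]
  simp only [mean_uniformOfFintype_ofReal (Q.acceptProb₁_nonneg D _)]
  change (mean _ fun ω => ENNReal.ofReal (Q.tapeProb D ω)).toReal = _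
  rw [mean_uniformOfFintype_ofReal fun ω => Q.tapeProb_nonneg D ω]
  exact ENNReal.toReal_ofReal (Finset.expect_nonneg fun ω _ => Q.tapeProb_nonneg D ω)

theorem Prover.acceptProb_le_one [Fintype M] : Q.acceptProb D ≤ 1 := by
  rw [Prover.acceptProb_eq]
  exact Finset.expect_le Finset.univ_nonempty fun ω _ => Q.tapeProb_le_one D ω

variable (κ : Set (ℕ × Transcript P L M)) (s : ℕ)

open Classical in
/-- The fraction of the accepted second challenges that make progress; `0` if no second challenge
is accepted. -/
def Prover.progressRatio [Module.Finite K L] : ℝ :=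
  (((Q.acceptedSet D ω c).filter fun I => Progress D κ s (Q.transcript ω c I)).card : ℝ) /
    (Q.acceptedSet D ω c).card

theorem Prover.progressRatio_nonneg [Module.Finite K L] : 0 ≤ Q.progressRatio D ω c κ s := by
  unfold Prover.progressRatio
  positivity

theorem Prover.progressRatio_le_one [Module.Finite K L] : Q.progressRatio D ω c κ s ≤ 1 := by
  classical
  refine div_le_one_of_le₀ ?_ (Nat.cast_nonneg _)
  exact_mod_cast Finset.card_filter_le _ _

variable {D Q ω c κ s}

theorem Prover.acceptProb₁_pos_of_accepted {I : Challenge₂ P}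
    (hI : (Q.transcript ω c I).Accepted D) : 0 < Q.acceptProb₁ D ω c := by
  have hS : (Q.acceptedSet D ω c).Nonempty := ⟨I, (Q.mem_acceptedSet D ω c).2 hI⟩
  exact div_pos (by exact_mod_cast hS.card_pos) (by exact_mod_cast Fintype.card_pos)

theorem Prover.le_progressRatio [Module.Finite K L] [IsScalarTower K L M] (hκ : Coherent D κ)
    {I : Challenge₂ P} (hI : (s, Q.transcript ω c I) ∈ κ) :
    1 - (1 + (P.ℓ : ℝ) * (falsePositives D κ s c).card) / (Q.acceptedSet D ω c).card ≤
      Q.progressRatio D ω c κ s := by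
  classical
  have hS : (Q.acceptedSet D ω c).Nonempty :=
    ⟨I, (Q.mem_acceptedSet D ω c).2 (hκ.accepted _ hI)⟩
  have hpos : (0 : ℝ) < (Q.acceptedSet D ω c).card := by exact_mod_cast hS.card_pos
  set R := (Q.acceptedSet D ω c).filter fun I => ¬ Progress D κ s (Q.transcript ω c I)
  have hle : (R.card : ℝ) ≤ 1 + P.ℓ * (falsePositives D κ s c).card := by
    refine mod_cast card_not_progress_le hκ hI fun I' hI' => ?_
    exact (Finset.mem_filter.1 hI').imp_left (Q.mem_acceptedSet D ω c).1
  have hadd : (((Q.acceptedSet D ω c).filter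
      fun I => Progress D κ s (Q.transcript ω c I)).card : ℝ) + R.card =
      (Q.acceptedSet D ω c).card := by
    exact_mod_cast Finset.card_filter_add_card_filter_not _
  rw [Prover.progressRatio, sub_le_iff_le_add, ← add_div, one_le_div hpos]
  linarith

end Probabilities

/-! ### The cost of a round -/

section Cost

/-- The expected number of calls when a first challenge with acceptance probability `p` is repeated
until acceptance.  The acceptance reduces the number of unopened parties from `n + 1` to `n`, or
gives an output, with probability `π`, and `V` is the cost of the calls after it; its argument is
shifted by one, so that `V n` belongs to `n - 1` unopened parties. -/
def responseCost (V : ℕ → ℝ) (n : ℕ) (p π : ℝ) : ℝ :=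
  1 / p + ((1 - π) * V (n + 1) + π * V n)

/-- The expected number of calls of a round: a call with a random first challenge, followed by the
repetition of that challenge if the call is accepted.  The call is accepted with probability `σ`,
the round makes progress with probability `g`, and the costs after it are `Y` without acceptance
and given by `V` otherwise. -/
def roundCost (V : ℕ → ℝ) (n : ℕ) (Y σ g : ℝ) : ℝ :=
  1 + ((1 - σ) * Y + ((σ - g) * V (n + 1) + g * V n))

variable {V : ℕ → ℝ} {n : ℕ}

theorem responseCost_nonneg (hV : ∀ n, 0 ≤ V n) {p π : ℝ} (hp : 0 ≤ p) (hπ₀ : 0 ≤ π)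
    (hπ₁ : π ≤ 1) : 0 ≤ responseCost V n p π :=
  add_nonneg (one_div_nonneg.2 hp)
    (add_nonneg (mul_nonneg (sub_nonneg.2 hπ₁) (hV _)) (mul_nonneg hπ₀ (hV _)))

theorem responseCost_le_responseCost (hV : Monotone V) {n' : ℕ} {p π π' : ℝ} (hπ : π ≤ 1)
    (hπ' : 0 ≤ π') (h : n' < n ∨ n' = n ∧ π ≤ π') :
    responseCost V n' p π' ≤ responseCost V n p π := by
  have hn' : V n' ≤ V (n' + 1) := hV n'.le_succ
  have hn : V n ≤ V (n + 1) := hV n.le_succ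
  refine add_le_add_right ?_ _
  rcases h with hlt | ⟨rfl, hle⟩
  · calc (1 - π') * V (n' + 1) + π' * V n' ≤ V (n' + 1) := by
          linarith [mul_le_mul_of_nonneg_left hn' hπ']
      _ ≤ V n := hV hlt
      _ ≤ (1 - π) * V (n + 1) + π * V n := by
          linarith [mul_le_mul_of_nonneg_left hn (sub_nonneg.2 hπ)]
  · linarith [mul_le_mul_of_nonneg_right hle (sub_nonneg.2 hn)]

theorem roundCost_nonneg (hV : ∀ n, 0 ≤ V n) {Y σ g : ℝ} (hY : 0 ≤ Y) (hσ : σ ≤ 1) (hg : 0 ≤ g)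
    (hgσ : g ≤ σ) : 0 ≤ roundCost V n Y σ g :=
  add_nonneg zero_le_one (add_nonneg (mul_nonneg (sub_nonneg.2 hσ) hY)
    (add_nonneg (mul_nonneg (sub_nonneg.2 hgσ) (hV _)) (mul_nonneg hg (hV _))))

variable {P : Params} {K L M : Type*} [Field K] [Field L] [Field M] [Fintype K] [Fintype M]
  [Algebra K L] [Algebra L M] [Algebra K M] (D : PublicData P K L M) (Q : Prover P L M)

/-- The amount by which the acceptance probability on a tape exceeds `ε`. -/
def Prover.excess (ε : ℝ) (ω : Q.Tape) : ℝ :=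
  max (Q.tapeProb D ω - ε) 0

theorem Prover.excess_nonneg (ε : ℝ) (ω : Q.Tape) : 0 ≤ Q.excess D ε ω :=
  le_max_right _ _

theorem Prover.excess_le_tapeProb {ε : ℝ} (hε : 0 ≤ ε) (ω : Q.Tape) :
    Q.excess D ε ω ≤ Q.tapeProb D ω :=
  max_le (sub_le_self _ hε) (Q.tapeProb_nonneg D ω)

variable (ω : Q.Tape) {m : Challenge₁ P M → ℝ}

theorem Prover.excess_le_expect {ε : ℝ} (hm : ∀ c, 0 ≤ m c)
    (hmε : ∑ c, m c ≤ Fintype.card (Challenge₁ P M) * (P.N.choose P.ℓ * ε)) :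
    Q.excess D ε ω ≤
      𝔼 c, Q.acceptProb₁ D ω c * max (1 - m c / (Q.acceptedSet D ω c).card) 0 := by
  have hcard₁ : (0 : ℝ) < Fintype.card (Challenge₁ P M) := by exact_mod_cast Fintype.card_pos
  have hcard₂ : (0 : ℝ) < Fintype.card (Challenge₂ P) := by exact_mod_cast Fintype.card_pos
  have hchoose : Fintype.card (Challenge₂ P) = P.N.choose P.ℓ := by simp [Challenge₂]
  refine max_le ?_ (Finset.expect_nonneg fun c _ =>
    mul_nonneg (Q.acceptProb₁_nonneg D ω c) (le_max_right _ _))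
  calc Q.tapeProb D ω - ε
      ≤ 𝔼 c, (Q.acceptProb₁ D ω c - m c / Fintype.card (Challenge₂ P)) := by
        rw [Finset.expect_sub_distrib, Prover.tapeProb]
        refine sub_le_sub_left ?_ _
        rw [Fintype.expect_eq_sum_div_card, ← Finset.sum_div, div_le_iff₀ hcard₁,
          div_le_iff₀ hcard₂, hchoose]
        linarith
    _ ≤ _ := Finset.expect_le_expect fun c _ => Q.acceptProb₁_sub_le D ω c (hm c)

theorem Prover.expect_round_le (hV : Monotone V) {ε : ℝ} (Y : ℝ) (hm : ∀ c, 0 ≤ m c)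
    (hmε : ∑ c, m c ≤ Fintype.card (Challenge₁ P M) * (P.N.choose P.ℓ * ε)) :
    𝔼 c, 𝔼 I, (if I ∈ Q.acceptedSet D ω c then responseCost V n (Q.acceptProb₁ D ω c)
        (max (1 - m c / (Q.acceptedSet D ω c).card) 0) else Y) ≤
      roundCost V n Y (Q.tapeProb D ω) (Q.excess D ε ω) := by
  set p := Q.acceptProb₁ D ω
  set t : Challenge₁ P M → ℝ := fun c => max (1 - m c / (Q.acceptedSet D ω c).card) 0
  have hround (c : Challenge₁ P M) :
      𝔼 I, (if I ∈ Q.acceptedSet D ω c then responseCost V n (p c) (t c) else Y) ≤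
        1 + ((1 - p c) * Y + p c * V (n + 1)) - p c * t c * (V (n + 1) - V n) := by
    have hp : p c * (1 / p c) ≤ 1 := by
      rw [mul_one_div]
      exact div_self_le_one _
    rw [expect_ite_mem, ← Prover.acceptProb₁, responseCost]
    linarith
  have hprogress := mul_le_mul_of_nonneg_right (Q.excess_le_expect D ω hm hmε)
    (sub_nonneg.2 (hV n.le_succ))
  calc _ ≤ 𝔼 c, (1 + ((1 - p c) * Y + p c * V (n + 1)) - p c * t c * (V (n + 1) - V n)) :=
        Finset.expect_le_expect fun c _ => hround c
    _ = 1 + ((1 - Q.tapeProb D ω) * Y + Q.tapeProb D ω * V (n + 1)) -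
          (𝔼 c, p c * t c) * (V (n + 1) - V n) := by
        rw [Finset.expect_sub_distrib, Finset.expect_add_distrib, Finset.expect_add_distrib,
          Fintype.expect_const, ← Finset.expect_mul, ← Finset.expect_mul, ← Finset.expect_mul,
          Finset.expect_sub_distrib, Fintype.expect_const, Prover.tapeProb]
    _ ≤ _ := by
        rw [roundCost]
        linarith

end Cost

/-! ### The extractor -/

section Extraction

variable {P : Params} {K L M : Type*} [Field K] [Field L] [Field M]
  [Fintype K] [Algebra K L] [Algebra L M] [Algebra K M]

/-- What the extractor does next: start a new session, draw new challenges in the current session,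
or repeat the first challenge of the last call. -/
inductive Mode where
  | fresh
  | commit
  | response

open Classical in
/-- The mode after a call.  The memory of a call is `0`, `1`, `2` if it was made in the mode
`fresh`, `commit`, `response`. -/
def Call.mode (D : PublicData P K L M) (C : Call P L M) : Mode :=
  if C.T.Accepted D then if C.memo = 2 then .commit else .response
  else if C.memo = 0 then .fresh else if C.memo = 1 then .commit else .response

theorem Call.accepted_of_mode_eq_response {D : PublicData P K L M} {C : Call P L M}
    (hmode : C.mode D = .response) (hC : C.memo = 0 ∨ C.memo = 1) : C.T.Accepted D := by
  by_contra hacc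
  rw [Call.mode, if_neg hacc] at hmode
  rcases hC with hC | hC <;> simp [hC] at hmode

/-- The mode after a list of calls. -/
def lastMode (D : PublicData P K L M) (h : List (Call P L M)) : Mode :=
  (h.getLast?.map (Call.mode D)).getD .fresh

theorem lastMode_append (D : PublicData P K L M) (h : List (Call P L M)) (C : Call P L M) :
    lastMode D (h ++ [C]) = C.mode D := by
  simp [lastMode]

theorem eq_append_of_lastMode_ne_fresh {α : Type*} {D : PublicData P K L M}
    {h : List (α × Call P L M)} (hmode : lastMode D (h.map Prod.snd) ≠ .fresh) :
    ∃ h' y, h = h' ++ [y] ∧ y.2.mode D = lastMode D (h.map Prod.snd) := by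
  rcases List.eq_nil_or_concat h with rfl | ⟨h', y, rfl⟩
  · exact absurd rfl hmode
  · exact ⟨h', y, List.concat_eq_append, by simp [lastMode]⟩

open Classical in
/-- The extractor.  New sessions are started until a call is accepted.  After an accepted call with
a new first challenge, that challenge is repeated until the next acceptance, in order to find a
collision of the hash function; then new first challenges are drawn, except that before each such
call the session is given up with probability `p`.  The extractor stops as soon as a valid output
can be read off. -/
def extractor [Module.Finite K L] (D : PublicData P K L M) (p : unitInterval) :
    Extractor P L M where
  next h := match lastMode D h with
    | .fresh => PMF.pure (0, .fresh)
    | .commit => (coin p).map fun giveUp =>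
        bif giveUp then (0, .fresh) else (1, .rewindCommit (h.length - 1))
    | .response => PMF.pure (2, .rewindResponse (h.length - 1))
  out h := if hf : Found D (knowledge D h) then some hf.choose else none

theorem extractor_correct [Module.Finite K L] (D : PublicData P K L M) (p : unitInterval) :
    (extractor D p).Correct D := by
  intro h o ho
  simp only [extractor] at ho
  split_ifs at ho with hf
  obtain rfl := Option.some_inj.1 ho
  exact ⟨hf.choose_spec.1, hf.choose_spec.2.readOff⟩

theorem extractor_out_eq_none [Module.Finite K L] {D : PublicData P K L M} {p : unitInterval}
    {h : List (Call P L M)} : (extractor D p).out h = none ↔ ¬ Found D (knowledge D h) := by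
  simp [extractor]

/-! ### Reachable lists of calls -/

/-- The properties of the lists of calls that the extractor can produce. -/
structure Reachable (D : PublicData P K L M) (Q : Prover P L M)
    (h : List (Q.Tape × Call P L M)) : Prop where
  transcript_eq : ∀ x ∈ h, x.2.T = Q.transcript x.1 x.2.T.ch₁ x.2.T.ch₂
  session_lt : ∀ x ∈ h, x.2.session < h.length
  tape_eq : ∀ x ∈ h, ∀ y ∈ h, x.2.session = y.2.session → x.1 = y.1
  exists_accepted : ∀ x ∈ h, x.2.mode D = .response →
    ∃ I, (Q.transcript x.1 x.2.T.ch₁ I).Accepted D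

variable {D : PublicData P K L M} {Q : Prover P L M} {h : List (Q.Tape × Call P L M)}

theorem reachable_nil : Reachable D Q [] :=
  ⟨by simp, by simp, by simp, by simp⟩

theorem Reachable.append (hR : Reachable D Q h) {x : Q.Tape × Call P L M}
    (hT : x.2.T = Q.transcript x.1 x.2.T.ch₁ x.2.T.ch₂) (hs : x.2.session ≤ h.length)
    (htape : ∀ y ∈ h, y.2.session = x.2.session → y.1 = x.1)
    (hacc : x.2.mode D = .response → ∃ I, (Q.transcript x.1 x.2.T.ch₁ I).Accepted D) :
    Reachable D Q (h ++ [x]) where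
  transcript_eq := by
    rw [List.forall_mem_append, List.forall_mem_singleton]
    exact ⟨hR.transcript_eq, hT⟩
  session_lt := by
    rw [List.forall_mem_append, List.forall_mem_singleton, List.length_append,
      List.length_singleton, Nat.lt_succ_iff]
    exact ⟨fun y hy => (hR.session_lt y hy).trans (Nat.lt_succ_self _), hs⟩
  tape_eq := by
    simp only [List.forall_mem_append, List.forall_mem_singleton, forall_const, and_true]
    exact ⟨fun y hy => ⟨hR.tape_eq y hy, htape y hy⟩,
      fun y hy hys => (htape y hy hys.symm).symm⟩
  exists_accepted := by
    rw [List.forall_mem_append, List.forall_mem_singleton]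
    exact ⟨hR.exists_accepted, hacc⟩

theorem Reachable.append_fresh (hR : Reachable D Q h) (ω : Q.Tape) (c : Challenge₁ P M)
    (I : Challenge₂ P) : Reachable D Q (h ++ [(ω, ⟨h.length, 0, Q.transcript ω c I⟩)]) :=
  hR.append rfl le_rfl (fun y hy hs => absurd hs (hR.session_lt y hy).ne)
    fun hmode => ⟨I, Call.accepted_of_mode_eq_response hmode (Or.inl rfl)⟩

theorem Reachable.append_rewind (hR : Reachable D Q h) {y : Q.Tape × Call P L M} (hy : y ∈ h)
    {a : ℕ} {c : Challenge₁ P M} {I : Challenge₂ P}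
    (hac : a = 1 ∨ c = y.2.T.ch₁ ∧ y.2.mode D = .response) :
    Reachable D Q (h ++ [(y.1, ⟨y.2.session, a, Q.transcript y.1 c I⟩)]) := by
  refine hR.append rfl (hR.session_lt y hy).le (fun z hz hs => hR.tape_eq z hz y hy hs)
    fun hmode => ?_
  rcases hac with rfl | ⟨rfl, hresponse⟩
  · exact ⟨I, Call.accepted_of_mode_eq_response hmode (Or.inr rfl)⟩
  · exact hR.exists_accepted y hy hresponse

theorem Reachable.coherent (hR : Reachable D Q h) :
    Coherent D (knowledge D (h.map Prod.snd)) where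
  accepted p hp := hp.1
  root_eq := by
    rintro ⟨s, _⟩ ⟨-, C, hC, rfl, rfl⟩ ⟨s', _⟩ ⟨-, C', hC', rfl, rfl⟩ hs
    obtain ⟨x, hx, rfl⟩ := List.mem_map.1 hC
    obtain ⟨x', hx', rfl⟩ := List.mem_map.1 hC'
    simp only
    rw [hR.transcript_eq x hx, hR.transcript_eq x' hx', hR.tape_eq x hx x' hx' hs]
    rfl

theorem Reachable.coherent_insert {x : Q.Tape × Call P L M} (hR : Reachable D Q (h ++ [x]))
    (hacc : x.2.T.Accepted D) :
    Coherent D (insert (x.2.session, x.2.T) (knowledge D (h.map Prod.snd))) := by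
  have hcoherent := hR.coherent
  rwa [List.map_append, List.map_singleton, knowledge_append_of_accepted D _ hacc] at hcoherent

theorem Reachable.append_of_mem_support [Module.Finite K L] [Fintype M] (hR : Reachable D Q h)
    {p : unitInterval} {ν : ℕ × Move}
    (hν : ν ∈ ((extractor D p).next (h.map Prod.snd)).support)
    {x : Q.Tape × Call P L M} (hx : x ∈ (Q.move h ν.1 ν.2).support) :
    Reachable D Q (h ++ [x]) := by
  have hfresh : ∀ x ∈ (Q.move h 0 .fresh).support, Reachable D Q (h ++ [x]) := fun x hx => by
    obtain ⟨ω, c, I, rfl⟩ := mem_support_freshCall hx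
    exact hR.append_fresh ω c I
  simp only [extractor, List.length_map] at hν
  cases hmode : lastMode D (h.map Prod.snd) with
  | fresh =>
    rw [hmode] at hν
    obtain rfl := (PMF.mem_support_pure_iff _ _).1 hν
    exact hfresh x hx
  | commit =>
    obtain ⟨h', y, rfl, -⟩ := eq_append_of_lastMode_ne_fresh (D := D) (h := h) (by simp [hmode])
    rw [hmode] at hν
    obtain ⟨giveUp, -, rfl⟩ := (PMF.mem_support_map_iff _ _ _).1 hν
    cases giveUp with
    | true => exact hfresh x hx
    | false =>
      simp only [cond_false, move_rewindCommit_last] at hx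
      obtain ⟨c, I, rfl, -⟩ := mem_support_call hx
      exact hR.append_rewind (by simp) (Or.inl rfl)
  | response =>
    obtain ⟨h', y, rfl, hy⟩ := eq_append_of_lastMode_ne_fresh (D := D) (h := h) (by simp [hmode])
    rw [hmode] at hν
    obtain rfl := (PMF.mem_support_pure_iff _ _).1 hν
    simp only [move_rewindResponse_last] at hx
    obtain ⟨c, I, rfl, hc⟩ := mem_support_call hx
    exact hR.append_rewind (by simp) (Or.inr ⟨hc _ rfl, hy.trans hmode⟩)

end Extraction

/-! ### The change of the knowledge by a call -/

section NewKnowledge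

variable {P : Params} {K L M : Type*}

/-- The number of parties that were not opened in session `s`. -/
def unopenedCount (κ : Set (ℕ × Transcript P L M)) (s : ℕ) : ℕ :=
  P.N - (openedParties κ s).card

variable {κ κ' : Set (ℕ × Transcript P L M)} {s : ℕ}

theorem unopenedCount_lt_unopenedCount_iff :
    unopenedCount κ' s < unopenedCount κ s ↔
      (openedParties κ s).card < (openedParties κ' s).card := by
  have hle (κ : Set (ℕ × Transcript P L M)) : (openedParties κ s).card ≤ P.N :=
    (Finset.card_le_univ _).trans_eq (Fintype.card_fin _)
  have := hle κ
  have := hle κ'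
  unfold unopenedCount
  omega

theorem unopenedCount_lt_or_openedParties_eq (hκ : κ ⊆ κ') :
    unopenedCount κ' s < unopenedCount κ s ∨ openedParties κ' s = openedParties κ s := by
  have hsub := openedParties_mono hκ s
  rw [unopenedCount_lt_unopenedCount_iff]
  refine (Finset.card_le_card hsub).lt_or_eq.imp_right fun hcard => ?_
  exact (Finset.eq_of_subset_of_card_le hsub hcard.ge).symm

theorem unopenedCount_anti (hκ : κ ⊆ κ') (s : ℕ) : unopenedCount κ' s ≤ unopenedCount κ s :=
  Nat.sub_le_sub_left (Finset.card_le_card (openedParties_mono hκ s)) _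

theorem openedParties_insert_of_new_session (hs : ∀ p ∈ κ, p.1 ≠ s) (T : Transcript P L M) :
    openedParties (insert (s, T) κ) s = T.ch₂.1 := by
  ext i
  rw [mem_openedParties]
  constructor
  · rintro ⟨-, T', hT' | hT', hi, -⟩
    · obtain rfl := (Prod.mk.inj hT').2
      exact hi
    · exact absurd rfl (hs _ hT')
  · exact fun hi => ⟨_, T, Or.inl rfl, hi, rfl⟩

variable [Field K] [Field L] [Field M] [Fintype K] [Algebra K L] [Algebra L M] [Algebra K M]
  {D : PublicData P K L M}

theorem openedState_eq_of_subset [Module.Finite K L] (hκ : κ ⊆ κ') (hκ' : Coherent D κ')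
    (hf : ¬ Found D κ') {i : Fin P.N} (hi : i ∈ openedParties κ s) :
    openedState κ' s i = openedState κ s i :=
  (opened_openedState (openedParties_mono hκ s hi)).unique hκ' hf
    ((opened_openedState hi).mono hκ)

variable [IsScalarTower K L M]

theorem falsePositives_eq_empty (h : (openedParties κ s).card ≤ P.ℓ) (c : Challenge₁ P M) :
    falsePositives D κ s c = ∅ := by
  rw [falsePositives, Finset.powersetCard_eq_empty.2 (Nat.lt_succ_of_le h), Finset.filter_empty]

variable [Module.Finite K L]

theorem falsePositives_eq_of_subset (hκ : κ ⊆ κ') (hκ' : Coherent D κ') (hf : ¬ Found D κ')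
    (h : openedParties κ' s = openedParties κ s) (c : Challenge₁ P M) :
    falsePositives D κ' s c = falsePositives D κ s c := by
  classical
  rw [falsePositives, falsePositives, h]
  refine Finset.filter_congr fun J hJ => ?_
  rw [reconstructState_congr D fun i hi =>
    openedState_eq_of_subset hκ hκ' hf ((Finset.mem_powersetCard.1 hJ).1 hi)]

variable {Q : Prover P L M} {ω : Q.Tape} {c : Challenge₁ P M}
  {I : Challenge₂ P}

theorem Prover.le_progressRatio_of_new_session
    (hκ : Coherent D (insert (s, Q.transcript ω c I) κ)) (hs : ∀ p ∈ κ, p.1 ≠ s) :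
    1 - 1 / ((Q.acceptedSet D ω c).card : ℝ) ≤
      Q.progressRatio D ω c (insert (s, Q.transcript ω c I) κ) s := by
  have hcard : (openedParties (insert (s, Q.transcript ω c I) κ) s).card ≤ P.ℓ := by
    rw [openedParties_insert_of_new_session hs]
    exact I.2.le
  have h := Prover.le_progressRatio hκ (Set.mem_insert _ _)
  rwa [falsePositives_eq_empty hcard, Finset.card_empty, Nat.cast_zero, mul_zero, add_zero] at h

theorem Prover.le_progressRatio_insert (hκ : Coherent D (insert (s, Q.transcript ω c I) κ))
    (hf : ¬ Found D (insert (s, Q.transcript ω c I) κ))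
    (h : openedParties (insert (s, Q.transcript ω c I) κ) s = openedParties κ s) :
    1 - (1 + (P.ℓ : ℝ) * (falsePositives D κ s c).card) / (Q.acceptedSet D ω c).card ≤
      Q.progressRatio D ω c (insert (s, Q.transcript ω c I) κ) s := by
  rw [← falsePositives_eq_of_subset (Set.subset_insert _ _) hκ hf h]
  exact Prover.le_progressRatio hκ (Set.mem_insert _ _)

end NewKnowledge

/-! ### The potential -/

section Potential

variable {P : Params} {K L M : Type*} [Field K] [Field L] [Field M] [Fintype K] [Fintype M]
  [Algebra K L] [Algebra L M] [Algebra K M] (D : PublicData P K L M) (Q : Prover P L M)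

/-- A lower bound for the probability that a session on tape `ω` makes progress before it is given
up, if this happens with probability `μ / (1 + μ)` before each call. -/
def Prover.progressBound (ε μ : ℝ) (ω : Q.Tape) : ℝ :=
  Q.excess D ε ω / (Q.excess D ε ω + μ)

/-- A bound for the expected number of calls when a session on tape `ω` with `n - 1` unopened
parties is continued with new first challenges: `2 / μ` accounts for the calls of the session, and
`B` for those after it has been given up. -/
def Prover.tapeCost (ε μ B : ℝ) (ω : Q.Tape) (n : ℕ) : ℝ :=
  2 / μ + B * (1 - Q.progressBound D ε μ ω ^ n)

/-- A bound for the expected number of calls after the start of a new session, where `B` is a bound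
for the situation before it. -/
def Prover.sessionCost (ε μ B : ℝ) : ℝ :=
  𝔼 ω, roundCost (Q.tapeCost D ε μ B ω) (P.N - P.ℓ) B (Q.tapeProb D ω) (Q.excess D ε ω)

/-- The potential after the call `x`, when the accepted transcripts are `κ` and contain no
output. -/
def callPotential [Module.Finite K L] (ε μ B : ℝ) (κ : Set (ℕ × Transcript P L M))
    (x : Q.Tape × Call P L M) : ℝ :=
  let V := Q.tapeCost D ε μ B x.1
  let n := unopenedCount κ x.2.session
  match x.2.mode D with
  | .fresh => B
  | .commit => V (n + 1)
  | .response => responseCost V n (Q.acceptProb₁ D x.1 x.2.T.ch₁)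
      (Q.progressRatio D x.1 x.2.T.ch₁ κ x.2.session)

open Classical in
/-- The potential of a list of calls: a bound for the expected number of further calls. -/
def potential [Module.Finite K L] (ε μ B : ℝ) (h : List (Q.Tape × Call P L M)) : ℝ≥0∞ :=
  if Found D (knowledge D (h.map Prod.snd)) then 0
  else ENNReal.ofReal
    (h.getLast?.elim B (callPotential D Q ε μ B (knowledge D (h.map Prod.snd))))

variable {ε μ B : ℝ}

section TapeCost

variable (ω : Q.Tape)

theorem Prover.progressBound_nonneg (hμ : 0 < μ) : 0 ≤ Q.progressBound D ε μ ω :=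
  div_nonneg (Q.excess_nonneg D ε ω) (add_nonneg (Q.excess_nonneg D ε ω) hμ.le)

theorem Prover.progressBound_le_one (hμ : 0 < μ) : Q.progressBound D ε μ ω ≤ 1 :=
  div_le_one_of_le₀ (le_add_of_nonneg_right hμ.le) (add_nonneg (Q.excess_nonneg D ε ω) hμ.le)

theorem Prover.tapeCost_nonneg (hμ : 0 < μ) (hB : 0 ≤ B) (n : ℕ) :
    0 ≤ Q.tapeCost D ε μ B ω n :=
  add_nonneg (by positivity) (mul_nonneg hB (sub_nonneg.2
    (pow_le_one₀ (Q.progressBound_nonneg D ω hμ) (Q.progressBound_le_one D ω hμ))))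

theorem Prover.tapeCost_monotone (hμ : 0 < μ) (hB : 0 ≤ B) :
    Monotone (Q.tapeCost D ε μ B ω) := fun _ _ hmn =>
  add_le_add_right (mul_le_mul_of_nonneg_left (sub_le_sub_left (pow_le_pow_of_le_one
    (Q.progressBound_nonneg D ω hμ) (Q.progressBound_le_one D ω hμ) hmn) _) hB) _

theorem Prover.roundCost_tapeCost (hμ : 0 < μ) (n : ℕ) :
    roundCost (Q.tapeCost D ε μ B ω) n (Q.tapeCost D ε μ B ω (n + 1)) (Q.tapeProb D ω)
        (Q.excess D ε ω) =
      1 + Q.tapeCost D ε μ B ω (n + 1) - B * μ * Q.progressBound D ε μ ω ^ (n + 1) := by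
  have hρ : Q.progressBound D ε μ ω * (Q.excess D ε ω + μ) = Q.excess D ε ω :=
    div_mul_cancel₀ _ (add_pos_of_nonneg_of_pos (Q.excess_nonneg D ε ω) hμ).ne'
  simp only [roundCost, Prover.tapeCost, pow_succ]
  linear_combination (B * Q.progressBound D ε μ ω ^ n) * hρ

theorem Prover.roundCost_tapeCost_nonneg (hμ : 0 < μ) (hB : 0 ≤ B) (hε : 0 ≤ ε) {Y : ℝ}
    (hY : 0 ≤ Y) (n : ℕ) :
    0 ≤ roundCost (Q.tapeCost D ε μ B ω) n Y (Q.tapeProb D ω) (Q.excess D ε ω) :=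
  roundCost_nonneg (Q.tapeCost_nonneg D ω hμ hB) hY (Q.tapeProb_le_one D ω)
    (Q.excess_nonneg D ε ω) (Q.excess_le_tapeProb D hε ω)

theorem Prover.one_add_giveUp_or_roundCost (hμ : 0 < μ) {p : ℝ} (hp : p * (1 + μ) = μ) (n : ℕ) :
    let V := Q.tapeCost D ε μ B ω
    1 + (p * (B - 1) + (1 - p) *
      roundCost V n (V (n + 1)) (Q.tapeProb D ω) (Q.excess D ε ω)) = V (n + 1) := by
  intro V
  have hpμ : p * (2 / μ) = 2 * (1 - p) := by
    field_simp
    linear_combination hp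
  rw [Q.roundCost_tapeCost D ω hμ]
  simp only [V, Prover.tapeCost]
  linear_combination -hpμ + B * Q.progressBound D ε μ ω ^ (n + 1) * hp

end TapeCost

variable [Module.Finite K L] {D Q} {h : List (Q.Tape × Call P L M)}

theorem potential_append_of_not_accepted {x : Q.Tape × Call P L M}
    (hf : ¬ Found D (knowledge D (h.map Prod.snd))) (hx : ¬ x.2.T.Accepted D) :
    potential D Q ε μ B (h ++ [x]) =
      ENNReal.ofReal (callPotential D Q ε μ B (knowledge D (h.map Prod.snd)) x) := by
  rw [potential, List.map_append, List.map_singleton, knowledge_append_of_not_accepted D _ hx,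
    if_neg hf, List.getLast?_concat, Option.elim_some]

theorem potential_append_of_accepted_le {x : Q.Tape × Call P L M} {y : ℝ}
    (hx : x.2.T.Accepted D)
    (hy : ¬ Found D (insert (x.2.session, x.2.T) (knowledge D (h.map Prod.snd))) →
      callPotential D Q ε μ B
        (insert (x.2.session, x.2.T) (knowledge D (h.map Prod.snd))) x ≤ y) :
    potential D Q ε μ B (h ++ [x]) ≤ ENNReal.ofReal y := by
  rw [potential, List.map_append, List.map_singleton, knowledge_append_of_accepted D _ hx,
    List.getLast?_concat, Option.elim_some]
  split_ifs with hf
  · exact zero_le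
  · exact ENNReal.ofReal_le_ofReal (hy hf)

theorem potential_append_of_not_found {y : Q.Tape × Call P L M}
    (hf : ¬ Found D (knowledge D ((h ++ [y]).map Prod.snd))) :
    potential D Q ε μ B (h ++ [y]) =
      ENNReal.ofReal (callPotential D Q ε μ B (knowledge D ((h ++ [y]).map Prod.snd)) y) := by
  rw [potential, if_neg hf, List.getLast?_concat, Option.elim_some]

theorem potential_of_lastMode_eq_fresh (hf : ¬ Found D (knowledge D (h.map Prod.snd)))
    (hmode : lastMode D (h.map Prod.snd) = .fresh) :
    potential D Q ε μ B h = ENNReal.ofReal B := by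
  rcases List.eq_nil_or_concat' h with rfl | ⟨h', y, rfl⟩
  · rw [potential, if_neg hf, List.getLast?_nil, Option.elim_none]
  · rw [List.map_append, List.map_singleton, lastMode_append] at hmode
    rw [potential_append_of_not_found hf]
    simp only [callPotential, hmode]

theorem mean_potential_call_none_le (hμ : 0 < μ) (hB : 0 ≤ B)
    (hf : ¬ Found D (knowledge D (h.map Prod.snd))) {ω : Q.Tape} {s a n : ℕ} (ha : a ≠ 2)
    {m : Challenge₁ P M → ℝ} (hm : ∀ c, 0 ≤ m c)
    (hmε : ∑ c, m c ≤ Fintype.card (Challenge₁ P M) * (P.N.choose P.ℓ * ε)) {Y : ℝ} (hY : 0 ≤ Y)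
    (hreject : ∀ c I, ¬ (Q.transcript ω c I).Accepted D → callPotential D Q ε μ B
      (knowledge D (h.map Prod.snd)) (ω, ⟨s, a, Q.transcript ω c I⟩) = Y)
    (haccept : ∀ c I, (Q.transcript ω c I).Accepted D →
      let κ := insert (s, Q.transcript ω c I) (knowledge D (h.map Prod.snd))
      ¬ Found D κ → unopenedCount κ s < n ∨ unopenedCount κ s = n ∧
        1 - m c / (Q.acceptedSet D ω c).card ≤ Q.progressRatio D ω c κ s) :
    mean (Q.call ω s a none) (fun x => potential D Q ε μ B (h ++ [x])) ≤
      ENNReal.ofReal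
        (roundCost (Q.tapeCost D ε μ B ω) n Y (Q.tapeProb D ω) (Q.excess D ε ω)) := by
  classical
  have hle_one (c : Challenge₁ P M) : max (1 - m c / (Q.acceptedSet D ω c).card) 0 ≤ 1 :=
    max_le (sub_le_self _ (div_nonneg (hm c) (Nat.cast_nonneg _))) zero_le_one
  refine (mean_call_none_le Q ω s a
    (f := fun c I => if I ∈ Q.acceptedSet D ω c then
      responseCost (Q.tapeCost D ε μ B ω) n (Q.acceptProb₁ D ω c)
        (max (1 - m c / (Q.acceptedSet D ω c).card) 0) else Y)
    (fun c I => ?_) fun c I => ?_).trans (ENNReal.ofReal_le_ofReal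
      (Q.expect_round_le D ω (Q.tapeCost_monotone D ω hμ hB) Y hm hmε))
  · exact ite_nonneg (responseCost_nonneg (Q.tapeCost_nonneg D ω hμ hB)
      (Q.acceptProb₁_nonneg D ω c) (le_max_right _ _) (hle_one c)) hY
  · by_cases hacc : (Q.transcript ω c I).Accepted D
    · rw [if_pos ((Q.mem_acceptedSet D ω c).2 hacc)]
      refine potential_append_of_accepted_le hacc fun hnf => ?_
      have hmode : (⟨s, a, Q.transcript ω c I⟩ : Call P L M).mode D = .response := by
        rw [Call.mode, if_pos hacc, if_neg ha]
      simp only [callPotential, hmode]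
      have hπ := Q.progressRatio_nonneg D ω c
        (insert (s, Q.transcript ω c I) (knowledge D (h.map Prod.snd))) s
      exact responseCost_le_responseCost (Q.tapeCost_monotone D ω hμ hB) (hle_one c) hπ
        ((haccept c I hacc hnf).imp_right (And.imp_right fun hle => max_le hle hπ))
    · rw [if_neg ((Q.mem_acceptedSet D ω c).not.2 hacc),
        potential_append_of_not_accepted hf hacc, hreject c I hacc]

open Classical in
theorem potential_append_of_memo_eq_two_le (hμ : 0 < μ) (hB : 0 ≤ B)
    (hf : ¬ Found D (knowledge D (h.map Prod.snd))) (ω : Q.Tape) (s : ℕ) (c : Challenge₁ P M)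
    (I : Challenge₂ P) :
    let κ := knowledge D (h.map Prod.snd)
    let V := Q.tapeCost D ε μ B ω
    let n := unopenedCount κ s
    potential D Q ε μ B (h ++ [(ω, ⟨s, 2, Q.transcript ω c I⟩)]) ≤
      ENNReal.ofReal (if I ∈ Q.acceptedSet D ω c then
        if Progress D κ s (Q.transcript ω c I) then V n else V (n + 1)
        else responseCost V n (Q.acceptProb₁ D ω c) (Q.progressRatio D ω c κ s)) := by
  intro κ V n
  by_cases hacc : (Q.transcript ω c I).Accepted D
  · refine potential_append_of_accepted_le hacc fun hnf => ?_
    have hmode : (⟨s, 2, Q.transcript ω c I⟩ : Call P L M).mode D = .commit := by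
      rw [Call.mode, if_pos hacc, if_pos rfl]
    simp only [callPotential, hmode, if_pos ((Q.mem_acceptedSet D ω c).2 hacc)]
    split_ifs with hprogress
    · refine Q.tapeCost_monotone D ω hμ hB (Nat.succ_le_of_lt ?_)
      exact unopenedCount_lt_unopenedCount_iff.2 (hprogress.resolve_left hnf)
    · refine Q.tapeCost_monotone D ω hμ hB (Nat.succ_le_succ ?_)
      exact unopenedCount_anti (Set.subset_insert _ _) s
  · rw [potential_append_of_not_accepted hf hacc]
    have hmode : (⟨s, 2, Q.transcript ω c I⟩ : Call P L M).mode D = .response := by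
      simp [Call.mode, hacc]
    simp only [callPotential, hmode, if_neg ((Q.mem_acceptedSet D ω c).not.2 hacc)]
    exact le_rfl

theorem one_add_mean_potential_call_some_le (hμ : 0 < μ) (hB : 0 ≤ B)
    (hf : ¬ Found D (knowledge D (h.map Prod.snd))) {ω : Q.Tape} {s : ℕ} {c : Challenge₁ P M}
    (hc : 0 < Q.acceptProb₁ D ω c) :
    1 + mean (Q.call ω s 2 (some c)) (fun x => potential D Q ε μ B (h ++ [x])) ≤
      ENNReal.ofReal (responseCost (Q.tapeCost D ε μ B ω)
        (unopenedCount (knowledge D (h.map Prod.snd)) s) (Q.acceptProb₁ D ω c)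
        (Q.progressRatio D ω c (knowledge D (h.map Prod.snd)) s)) := by
  classical
  set κ := knowledge D (h.map Prod.snd)
  set V := Q.tapeCost D ε μ B ω
  set n := unopenedCount κ s
  set σ := Q.acceptProb₁ D ω c with hσ
  set π := Q.progressRatio D ω c κ s with hπ
  set f : Challenge₂ P → ℝ := fun I => if I ∈ Q.acceptedSet D ω c then
    if Progress D κ s (Q.transcript ω c I) then V n else V (n + 1) else responseCost V n σ π
  have hV := Q.tapeCost_nonneg (ε := ε) D ω hμ hB
  have hf₀ (I : Challenge₂ P) : 0 ≤ f I := ite_nonneg (ite_nonneg (hV _) (hV _))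
    (responseCost_nonneg hV hc.le (Q.progressRatio_nonneg D ω c κ s)
      (Q.progressRatio_le_one D ω c κ s))
  have hmean : 1 + 𝔼 I, f I = responseCost V n σ π := by
    rw [expect_ite_ite, ← Prover.acceptProb₁, ← Prover.progressRatio, ← hσ, ← hπ, responseCost]
    field_simp
    ring
  rw [← hmean, ENNReal.ofReal_add zero_le_one (Finset.expect_nonneg fun I _ => hf₀ I),
    ENNReal.ofReal_one]
  exact add_le_add_right (mean_call_some_le Q ω s 2 c hf₀ fun I =>
    potential_append_of_memo_eq_two_le hμ hB hf ω s c I) 1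

/-! ### The drift of the potential -/

theorem soundnessError_nonneg {N ℓ : ℕ} (hℓ : ℓ ≤ N) {p : ℝ} (hp : 0 ≤ p) :
    0 ≤ soundnessError N ℓ p := by
  have : 0 ≤ (N : ℝ) - ℓ := sub_nonneg.2 (Nat.cast_le.2 hℓ)
  rw [soundnessError]
  positivity

theorem one_le_choose_mul_of_soundnessError_le {p : ℝ} (hp : 0 ≤ p)
    (hε : soundnessError P.N P.ℓ p ≤ ε) : 1 ≤ P.N.choose P.ℓ * ε := by
  refine le_trans ?_ (mul_le_mul_of_nonneg_left hε (Nat.cast_nonneg _))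
  rw [choose_mul_soundnessError]
  exact le_add_of_nonneg_right (by positivity)

section Drift

variable [IsScalarTower K L M]
  (hε : soundnessError P.N P.ℓ (falsePositiveRate K L M) ≤ ε)
include hε

theorem Reachable.mean_potential_freshCall_le (hR : Reachable D Q h)
    (hf : ¬ Found D (knowledge D (h.map Prod.snd))) (hμ : 0 < μ) (hB : 0 ≤ B) :
    mean (Q.freshCall h.length 0) (fun x => potential D Q ε μ B (h ++ [x])) ≤
      ENNReal.ofReal (Q.sessionCost D ε μ B) := by
  have hε₀ : 0 ≤ ε := (soundnessError_nonneg P.ℓ_lt_N.le falsePositiveRate_nonneg).trans hε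
  have hnew : ∀ p ∈ knowledge D (h.map Prod.snd), p.1 ≠ h.length := by
    rintro ⟨_, _⟩ ⟨-, C, hC, rfl, rfl⟩
    obtain ⟨x, hx, rfl⟩ := List.mem_map.1 hC
    exact (hR.session_lt x hx).ne
  rw [Prover.freshCall, mean_bind]
  refine mean_uniformOfFintype_le (fun ω => Q.roundCost_tapeCost_nonneg D ω hμ hB hε₀ hB _)
    fun ω => mean_potential_call_none_le hμ hB hf (m := fun _ => 1) (by decide)
      (fun _ => zero_le_one) ?_ hB (fun c I hacc => ?_) fun c I hacc _ => Or.inr ⟨?_, ?_⟩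
  · rw [Finset.sum_const, Finset.card_univ, nsmul_eq_mul]
    exact mul_le_mul_of_nonneg_left
      (one_le_choose_mul_of_soundnessError_le falsePositiveRate_nonneg hε) (Nat.cast_nonneg _)
  · simp [callPotential, Call.mode, hacc]
  · rw [unopenedCount, openedParties_insert_of_new_session hnew]
    exact congrArg _ I.2
  · exact Prover.le_progressRatio_of_new_session ((hR.append_fresh ω c I).coherent_insert hacc)
      hnew

theorem Reachable.mean_potential_rewindCommit_le (hR : Reachable D Q h)
    (hf : ¬ Found D (knowledge D (h.map Prod.snd))) (hμ : 0 < μ) (hB : 0 ≤ B)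
    {y : Q.Tape × Call P L M} (hy : y ∈ h) :
    let V := Q.tapeCost D ε μ B y.1
    let n := unopenedCount (knowledge D (h.map Prod.snd)) y.2.session
    mean (Q.call y.1 y.2.session 1 none) (fun x => potential D Q ε μ B (h ++ [x])) ≤
      ENNReal.ofReal (roundCost V n (V (n + 1)) (Q.tapeProb D y.1) (Q.excess D ε y.1)) := by
  set κ := knowledge D (h.map Prod.snd)
  refine mean_potential_call_none_le hμ hB hf
    (m := fun c => 1 + (P.ℓ : ℝ) * (falsePositives D κ y.2.session c).card) (by decide)
    (fun c => by positivity) ?_ (Q.tapeCost_nonneg D y.1 hμ hB _) (fun c I hacc => ?_)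
    fun c I hacc hnf => ?_
  · refine (sum_one_add_card_falsePositives_le hf).trans ?_
    gcongr
  · simp [callPotential, Call.mode, hacc, κ]
  · refine (unopenedCount_lt_or_openedParties_eq (Set.subset_insert _ κ)).imp_right fun heq => ?_
    exact ⟨congrArg (fun R => P.N - Finset.card R) heq, Prover.le_progressRatio_insert
      ((hR.append_rewind hy (Or.inl rfl)).coherent_insert hacc) hnf heq⟩

theorem Reachable.one_add_mean_potential_giveUp_or_rewindCommit_le (hR : Reachable D Q h)
    (hf : ¬ Found D (knowledge D (h.map Prod.snd))) (hμ : 0 < μ) (hB : 1 ≤ B)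
    (hsession : Q.sessionCost D ε μ B ≤ B - 1) {p : unitInterval} (hp : (p : ℝ) * (1 + μ) = μ)
    {y : Q.Tape × Call P L M} (hy : y ∈ h) :
    1 + (ENNReal.ofReal p *
          mean (Q.freshCall h.length 0) (fun x => potential D Q ε μ B (h ++ [x])) +
        ENNReal.ofReal (1 - p) *
          mean (Q.call y.1 y.2.session 1 none) (fun x => potential D Q ε μ B (h ++ [x]))) ≤
      ENNReal.ofReal (Q.tapeCost D ε μ B y.1
        (unopenedCount (knowledge D (h.map Prod.snd)) y.2.session + 1)) := by
  have hB₀ : 0 ≤ B := zero_le_one.trans hB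
  have hε₀ : 0 ≤ ε := (soundnessError_nonneg P.ℓ_lt_N.le falsePositiveRate_nonneg).trans hε
  have hfresh := (hR.mean_potential_freshCall_le hε hf hμ hB₀).trans
    (ENNReal.ofReal_le_ofReal hsession)
  have hcommit := hR.mean_potential_rewindCommit_le hε hf hμ hB₀ hy
  set n := unopenedCount (knowledge D (h.map Prod.snd)) y.2.session
  have hgiveUp_nonneg : 0 ≤ (p : ℝ) * (B - 1) := mul_nonneg p.2.1 (sub_nonneg.2 hB)
  have hround_nonneg := mul_nonneg (sub_nonneg.2 p.2.2) (Q.roundCost_tapeCost_nonneg D y.1 hμ hB₀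
    hε₀ (Q.tapeCost_nonneg (ε := ε) D y.1 hμ hB₀ (n + 1)) n)
  refine (add_le_add_right (add_le_add (mul_le_mul_right hfresh _)
    (mul_le_mul_right hcommit _)) 1).trans_eq ?_
  rw [← ENNReal.ofReal_mul p.2.1, ← ENNReal.ofReal_mul (sub_nonneg.2 p.2.2),
    ← ENNReal.ofReal_add hgiveUp_nonneg hround_nonneg, ← ENNReal.ofReal_one,
    ← ENNReal.ofReal_add zero_le_one (add_nonneg hgiveUp_nonneg hround_nonneg),
    Q.one_add_giveUp_or_roundCost D y.1 hμ hp n]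

theorem Reachable.one_add_mean_potential_le (hR : Reachable D Q h)
    (hf : ¬ Found D (knowledge D (h.map Prod.snd))) (hμ : 0 < μ) (hB : 1 ≤ B)
    (hsession : Q.sessionCost D ε μ B ≤ B - 1) {p : unitInterval} (hp : (p : ℝ) * (1 + μ) = μ) :
    1 + mean ((extractor D p).next (h.map Prod.snd))
      (fun ν => mean (Q.move h ν.1 ν.2) fun x => potential D Q ε μ B (h ++ [x])) ≤
      potential D Q ε μ B h := by
  have hB₀ : 0 ≤ B := zero_le_one.trans hB
  cases hmode : lastMode D (h.map Prod.snd) with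
  | fresh =>
    have hfresh := (hR.mean_potential_freshCall_le hε hf hμ hB₀).trans
      (ENNReal.ofReal_le_ofReal hsession)
    simp only [extractor, hmode, mean_pure]
    calc 1 + mean (Q.freshCall h.length 0) (fun x => potential D Q ε μ B (h ++ [x]))
        ≤ ENNReal.ofReal 1 + ENNReal.ofReal (B - 1) := by
          rw [ENNReal.ofReal_one]
          exact add_le_add_right hfresh 1
      _ = potential D Q ε μ B h := by
          rw [← ENNReal.ofReal_add zero_le_one (sub_nonneg.2 hB), add_sub_cancel,
            potential_of_lastMode_eq_fresh hf hmode]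
  | commit =>
    obtain ⟨h', y, rfl, hy⟩ := eq_append_of_lastMode_ne_fresh (D := D) (h := h) (by simp [hmode])
    rw [potential_append_of_not_found hf]
    simp only [extractor, hmode, callPotential, hy.trans hmode, mean_map, mean_coin, cond_true,
      cond_false, List.length_map, move_rewindCommit_last]
    exact hR.one_add_mean_potential_giveUp_or_rewindCommit_le hε hf hμ hB hsession hp (by simp)
  | response =>
    obtain ⟨h', y, rfl, hy⟩ := eq_append_of_lastMode_ne_fresh (D := D) (h := h) (by simp [hmode])
    obtain ⟨I, hI⟩ := hR.exists_accepted y (by simp) (hy.trans hmode)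
    rw [potential_append_of_not_found hf]
    simp only [extractor, hmode, callPotential, hy.trans hmode, mean_pure, List.length_map,
      move_rewindResponse_last]
    exact one_add_mean_potential_call_some_le hμ hB₀ hf (Prover.acceptProb₁_pos_of_accepted hI)

end Drift

end Potential

/-! ### The bound -/

theorem exp_neg_one_le_pow {g x : ℝ} {k : ℕ} (hk : 0 < k) (hg : 0 < g) (hx : 0 ≤ x)
    (hkx : k * x ≤ g) : Real.exp (-1) ≤ (g / (g + x)) ^ k := by
  have hk' : (0 : ℝ) < k := Nat.cast_pos.2 hk
  have hratio : (g + x) / g ≤ Real.exp (1 / k) := by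
    rw [add_div, div_self hg.ne', add_comm]
    refine le_trans (add_le_add_left ?_ 1) (Real.add_one_le_exp _)
    rw [div_le_div_iff₀ hg hk']
    linarith
  calc Real.exp (-1) = (Real.exp (1 / k) ^ k)⁻¹ := by
        rw [← Real.exp_nat_mul, mul_one_div_cancel hk'.ne', Real.exp_neg]
    _ ≤ (((g + x) / g) ^ k)⁻¹ := by gcongr
    _ = (g / (g + x)) ^ k := by rw [← inv_pow, inv_div]

theorem sub_mul_exp_neg_one_le_mul_pow {g x : ℝ} {k : ℕ} (hk : 0 < k) (hg : 0 ≤ g) (hx : 0 < x) :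
    (g - k * x) * Real.exp (-1) ≤ g * (g / (g + x)) ^ k := by
  rcases le_or_gt g (k * x) with hle | hlt
  · exact (mul_nonpos_of_nonpos_of_nonneg (sub_nonpos.2 hle) (Real.exp_nonneg _)).trans
      (by positivity)
  · have hg₀ : 0 < g := lt_of_le_of_lt (by positivity) hlt
    calc (g - k * x) * Real.exp (-1) ≤ g * Real.exp (-1) := by
          gcongr
          exact sub_le_self _ (by positivity)
      _ ≤ _ := by
          gcongr
          exact exp_neg_one_le_pow hk hg₀ hx.le hlt.le

section Bound

variable {P : Params} {K L M : Type*} [Field K] [Field L] [Field M] [Fintype K] [Fintype M]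
  [Algebra K L] [Algebra L M] [Algebra K M] {D : PublicData P K L M} {Q : Prover P L M}
  {ε μ B : ℝ}

theorem Prover.roundCost_tapeCost_le (hε : 0 ≤ ε) (hμ : 0 < μ) (hB : 0 ≤ B) {k : ℕ} (hk : 0 < k)
    (ω : Q.Tape) :
    roundCost (Q.tapeCost D ε μ B ω) k B (Q.tapeProb D ω) (Q.excess D ε ω) ≤
      1 + B + 2 / μ * Q.tapeProb D ω - B * Real.exp (-1) * (Q.tapeProb D ω - ε - k * μ) := by
  set ρ := Q.progressBound D ε μ ω
  set g := Q.excess D ε ω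
  set σ := Q.tapeProb D ω
  have hexp : (σ - ε - k * μ) * Real.exp (-1) ≤ g * ρ ^ k :=
    le_trans (by gcongr; exact le_max_left _ _)
      (sub_mul_exp_neg_one_le_mul_pow hk (Q.excess_nonneg D ε ω) hμ)
  have hgσ : g * ρ ^ (k + 1) ≤ σ * ρ ^ (k + 1) := mul_le_mul_of_nonneg_right
    (Q.excess_le_tapeProb D hε ω) (pow_nonneg (Q.progressBound_nonneg D ω hμ) _)
  calc roundCost (Q.tapeCost D ε μ B ω) k B σ g
      = 1 + B + 2 / μ * σ - B * (g * ρ ^ k + (σ * ρ ^ (k + 1) - g * ρ ^ (k + 1))) := by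
        rw [roundCost, Prover.tapeCost, Prover.tapeCost]
        ring
    _ ≤ 1 + B + 2 / μ * σ - B * ((σ - ε - k * μ) * Real.exp (-1)) := by
        gcongr
        exact hexp.trans (le_add_of_nonneg_right (sub_nonneg.2 hgσ))
    _ = _ := by ring

theorem Prover.sessionCost_le (hε : 0 ≤ ε) (hμ : 0 < μ) (hB : 0 ≤ B) :
    Q.sessionCost D ε μ B ≤ 1 + B + 2 / μ * Q.acceptProb D -
      B * Real.exp (-1) * (Q.acceptProb D - ε - (P.N - P.ℓ : ℕ) * μ) := by
  refine (Finset.expect_le_expect fun ω _ =>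
    Q.roundCost_tapeCost_le hε hμ hB (Nat.sub_pos_of_lt P.ℓ_lt_N) ω).trans_eq ?_
  simp only [Finset.expect_sub_distrib, Finset.expect_add_distrib, ← Finset.mul_expect,
    Fintype.expect_const, Q.acceptProb_eq]

/-- The bound of the theorem for the expected number of calls, where `δ = ε' - ε` and
`k = N - ℓ`. -/
def callBound (δ k : ℝ) : ℝ :=
  4 / δ * (1 + 8 * k / δ)

theorem one_le_callBound {δ k : ℝ} (hδ : 0 < δ) (hδ₁ : δ ≤ 1) (hk : 0 ≤ k) :
    1 ≤ callBound δ k :=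
  one_le_mul_of_one_le_of_one_le ((one_le_div hδ).2 (by linarith))
    (le_add_of_nonneg_right (by positivity))

theorem two_add_le_callBound_mul_exp {δ k : ℝ} (hδ : 0 < δ) (hk : δ ≤ k) :
    2 + 4 * k / δ ≤ callBound δ k * Real.exp (-1) * (δ / 2) := by
  have hexp : 1 / 3 ≤ Real.exp (-1) := by
    rw [Real.exp_neg, one_div]
    exact inv_anti₀ (Real.exp_pos _) Real.exp_one_lt_three.le
  have hkδ : 1 ≤ k / δ := (one_le_div hδ).2 hk
  calc 2 + 4 * k / δ ≤ 2 * (1 + 8 * (k / δ)) * (1 / 3) := by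
        rw [mul_div_assoc]
        linarith
    _ ≤ 2 * (1 + 8 * (k / δ)) * Real.exp (-1) := by gcongr
    _ = callBound δ k * Real.exp (-1) * (δ / 2) := by
        rw [callBound]
        field_simp
        ring

theorem Prover.sessionCost_callBound_le (hε : 0 ≤ ε) {δ : ℝ} (hδ : 0 < δ)
    (hQ : ε + δ ≤ Q.acceptProb D) :
    let k : ℝ := (P.N - P.ℓ : ℕ)
    Q.sessionCost D ε (δ / (2 * k)) (callBound δ k) ≤ callBound δ k - 1 := by
  intro k
  have hk : 1 ≤ k := Nat.one_le_cast.2 (Nat.sub_pos_of_lt P.ℓ_lt_N)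
  have hk₀ : 0 < k := zero_lt_one.trans_le hk
  have hδ₁ : δ ≤ 1 := by linarith [Q.acceptProb_le_one D]
  have hB : 0 ≤ callBound δ k := zero_le_one.trans (one_le_callBound hδ hδ₁ hk₀.le)
  have hkμ : k * (δ / (2 * k)) = δ / 2 := by field_simp
  have hA : 2 / (δ / (2 * k)) * Q.acceptProb D ≤ 4 * k / δ :=
    (mul_le_of_le_one_right (by positivity) (Q.acceptProb_le_one D)).trans_eq
      (by field_simp; norm_num)
  have hgain : callBound δ k * Real.exp (-1) * (δ / 2) ≤
      callBound δ k * Real.exp (-1) * (Q.acceptProb D - ε - δ / 2) := by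
    gcongr
    linarith
  have hcost := Q.sessionCost_le (D := D) hε (by positivity : 0 < δ / (2 * k)) hB
  rw [hkμ] at hcost
  linarith [two_add_le_callBound_mul_exp hδ (hδ₁.trans hk)]

end Bound

theorem mainTheorem4_general (K L M : Type*) [Field K] [Field L] [Field M]
    [Fintype K] [Fintype M] [Algebra K L] [Module.Finite K L] [Algebra L M] [Algebra K M]
    [IsScalarTower K L M] (P : Params) (D : PublicData P K L M) (ε ε' : ℝ)
    (hε : ε = soundnessError P.N P.ℓ (falsePositiveRate K L M)) (hε' : ε < ε') :
    ∃ E : Extractor P L M, E.Correct D ∧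
      ∀ Q : Prover P L M, ε' ≤ Q.acceptProb D →
        E.expectedCalls Q ≤
          ENNReal.ofReal (4 / (ε' - ε) * (1 + 8 * ((P.N : ℝ) - P.ℓ) / (ε' - ε))) := by
  have hε₀ : 0 ≤ ε := hε ▸ soundnessError_nonneg P.ℓ_lt_N.le falsePositiveRate_nonneg
  have hδ : 0 < ε' - ε := sub_pos.2 hε'
  rw [← Nat.cast_sub P.ℓ_lt_N.le]
  set k : ℝ := ((P.N - P.ℓ : ℕ) : ℝ)
  have hk : 0 < k := Nat.cast_pos.2 (Nat.sub_pos_of_lt P.ℓ_lt_N)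
  set μ := (ε' - ε) / (2 * k)
  have hμ : 0 < μ := by positivity
  let p : unitInterval :=
    ⟨μ / (1 + μ), by positivity, div_le_one_of_le₀ (by linarith) (by positivity)⟩
  have hp : (p : ℝ) * (1 + μ) = μ := div_mul_cancel₀ _ (by positivity)
  refine ⟨extractor D p, extractor_correct D p, fun Q hQ => ?_⟩
  have hB : 1 ≤ callBound (ε' - ε) k :=
    one_le_callBound hδ (by linarith [Q.acceptProb_le_one D]) hk.le
  have hsession := Q.sessionCost_callBound_le (D := D) hε₀ hδ (by linarith)
  refine (Extractor.expectedCalls_le _ Q (potential D Q ε μ (callBound (ε' - ε) k)) (Reachable D Q)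
    reachable_nil (fun h hR ν hν x hx => hR.append_of_mem_support hν hx) fun h hR hout =>
      hR.one_add_mean_potential_le hε.ge (extractor_out_eq_none.1 hout) hμ hB hsession hp).trans ?_
  rw [potential]
  split_ifs
  exacts [zero_le, le_rfl]

end ThresholdRSD

end

open ThresholdRSD in
theorem mainTheorem4 (K L M : Type*) [Field K] [Field L] [Field M]
    [Fintype K] [Fintype L] [Fintype M] [Algebra K L] [Algebra L M] [Algebra K M]
    [IsScalarTower K L M] (P : Params) (D : PublicData P K L M) (ε ε' : ℝ)
    (hε : ε = soundnessError P.N P.ℓ (falsePositiveRate K L M)) (hε' : ε < ε') :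
    ∃ E : Extractor P L M, E.Correct D ∧
      ∀ Q : Prover P L M, Q.acceptProb D = ε' →
        E.expectedCalls Q ≤
          ENNReal.ofReal (4 / (ε' - ε) * (1 + 8 * ((P.N : ℝ) - P.ℓ) / (ε' - ε))) := by
  obtain ⟨E, hE, hcalls⟩ := mainTheorem4_general K L M P D ε ε' hε hε'
  exact ⟨E, hE, fun Q hQ => hcalls Q hQ.ge⟩
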